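/- Let $A$ be a unital C*-algebra and let $\mathcal C(A)$ be the set of its commutative unital C*-subalgebras, partially ordered by inclusion, with least element $\mathbb C=\mathbb C\cdot 1$. Let $\underline A_{\mathrm{sa}}$ be the object $C\mapsto C_{\mathrm{sa}}$ of the topos $[\mathcal C(A),\mathbf{Set}]$, with the inclusions as restriction maps. For a commutative unital C*-algebra $B$, let $L_B$ be the bounded distributive lattice freely generated by symbols $\mathtt D_a$ ($a\in B_{\mathrm{sa}}$) subject to $$\mathtt D_1=1,\quad \mathtt D_a\wedge \mathtt D_{-a}=0,\quad \mathtt D_{-b^2}=0,\quad \mathtt D_{a+b}\le \mathtt D_a\vee \mathtt D_b,\quad \mathtt D_{ab}=(\mathtt D_a\wedge \mathtt D_b)\vee(\mathtt D_{-a}\wedge \mathtt D_{-b}),\qquad(*)$$ let $\mathcal O(\Sigma(B))$ be the frame freely generated by the same symbols subject to $(*)$ and the regularity rule $\mathtt D_a\le\bigvee_{r\in\mathbb Q,\,r>0}\mathtt D_{a-r}$, and let $i_B\colon L_B\to\mathcal O(\Sigma(B))$ be the canonical map. For $x\in L_B$ and $U\subseteq L_B$ write $x\vartriangleleft_B U$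 if $i_B(x)\le\bigvee_{y\in U} i_B(y)$. Let $\underline L_{\underline A}\colon\mathcal C(A)\to\mathbf{Set}$ be the functor $C\mapsto L_C$ whose restriction maps $L_C\to L_D$ ($C\subseteq D$) are the lattice homomorphisms with $\mathtt D_c\mapsto \mathtt D_c$ for $c\in C_{\mathrm{sa}}$. Let $\mathcal O(\underline\Sigma(\underline A))$ be the internal Gelfand spectrum of the Bohrification of $A$, that is, the internal frame of $[\mathcal C(A),\mathbf{Set}]$ freely generated by symbols $\mathtt D_a$, $a\in\underline A_{\mathrm{sa}}$, subject to $(*)$ and the regularity rule. Then $\underline L_{\underline A}$ is the internal distributive lattice of $[\mathcal C(A),\mathbf{Set}]$ freely generated by symbols $\mathtt D_a$, $a\in\underline A_{\mathrm{sa}}$, subject to $(*)$; the internal frame $\mathcal O(\underline\Sigma(\underline A))$ exists; and it has the following description, up to an isomorphism under which the generator $\mathtt D_a$ ($a\in C_{\mathrm{sa}}$) at stage $C$ corresponds to the subfunctor $E\mapsto\{x\in L_E\mid x\vartriangleleft_E\{\mathtt D_a\}\}$. (a) For $C\in\mathcal C(A)$, the partially ordered set $\mathcal O(\underline\Sigma(\underline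 A))(C)$ consists of the subfunctors $\underline U$ of the restriction of $\underline L_{\underline A}$ to $\uparrow\! C=\{D\mid D\supseteq C\}$, ordered by inclusion, such that for all $D\supseteq C$ and $d\in L_D$, $d\vartriangleleft_D\underline U(D)$ implies $d\in\underline U(D)$. (b) In particular, $\mathcal O(\underline\Sigma(\underline A))(\mathbb C)$ consists of the subfunctors $\underline U$ of $\underline L_{\underline A}$ such that for all $C\in\mathcal C(A)$ and $c\in L_C$, $c\vartriangleleft_C\underline U(C)$ implies $c\in\underline U(C)$. (c) For $C\subseteq D$, the restriction map $\mathcal O(\underline\Sigma(\underline A))(C)\to\mathcal O(\underline\Sigma(\underline A))(D)$ is the truncation of $\underline U$ from $\uparrow\! C$ to $\uparrow\! D$. (d) Let $\mathrm{Alx}(\mathcal C(A))$ be $\mathcal C(A)$ with the Alexandrov topology, whose opens are the upper sets. The set $\mathcal O(\underline\Sigma(\underline A))(\mathbb C)$ is a frame, and the external description of $\underline\Sigma(\underline A)$ is the frame morphism $$f^{-1}\colon\mathcal O(\mathrm{Alx}(\mathcal C(A)))\to\mathcal O(\underline\Sigma(\underline A))(\mathbb C),\qquad f^{-1}(V)=l_V(1),$$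 where $l_V$ is the left adjoint, which exists, of the restriction of elements of $\mathcal O(\underline\Sigma(\underline A))(\mathbb C)$ to sections (compatible families) of $\mathcal O(\underline\Sigma(\underline A))$ over $V$. On basic opens it is given by $$f^{-1}(\uparrow\! D)(E)=\begin{cases}L_E&\text{if }E\supseteq D,\\ \{0\}&\text{otherwise,}\end{cases}$$ where $0$ is the least element of $L_E$. -/

import Mathlib

open CategoryTheory TopologicalSpace

universe u

/-! ## The spectral lattice of a commutative C*-algebra -/

/-- The relations that hold between the formal symbols `D a`, for self-adjoint elements `a` of a
commutative C*-algebra `B`, for a map `D` into a bounded lattice. -/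
structure SpectralRelations (B : Type*) [CommCStarAlgebra B] {X : Type*} [Lattice X]
    [BoundedOrder X] (D : selfAdjoint B → X) : Prop where
  one : D 1 = ⊤
  inf_neg : ∀ a, D a ⊓ D (-a) = ⊥
  neg_sq : ∀ b, D (-(b ^ 2)) = ⊥
  add_le : ∀ a b, D (a + b) ≤ D a ⊔ D b
  mul : ∀ a b, D (a * b) = (D a ⊓ D b) ⊔ (D (-a) ⊓ D (-b))

/-- The previous relations together with the regularity rule `D a ≤ ⋁ {D (a - r) | r ∈ ℚ, r > 0}`,
which is spelled out through upper bounds. -/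
structure GelfandRelations (B : Type*) [CommCStarAlgebra B] {X : Type*} [Lattice X]
    [BoundedOrder X] (D : selfAdjoint B → X) : Prop extends SpectralRelations B D where
  regular : ∀ a z, (∀ r : ℚ, 0 < r → D (a - (r : ℝ) • 1) ≤ z) → D a ≤ z

/-- Formal lattice expressions in the symbols `D a`. -/
inductive SpectralTerm (B : Type u) [CommCStarAlgebra B] : Type u
  | D : selfAdjoint B → SpectralTerm B
  | top : SpectralTerm B
  | bot : SpectralTerm B
  | inf : SpectralTerm B → SpectralTerm B → SpectralTerm B
  | sup : SpectralTerm B → SpectralTerm B → SpectralTerm B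

namespace SpectralTerm

/-- Provable inequality between formal expressions: the axioms of bounded distributive lattices and
the spectral relations. -/
inductive Le (B : Type u) [CommCStarAlgebra B] : SpectralTerm B → SpectralTerm B → Prop
  | refl (s) : Le B s s
  | trans {s t v} : Le B s t → Le B t v → Le B s v
  | le_top (s) : Le B s top
  | bot_le (s) : Le B bot s
  | inf_left (s t) : Le B (inf s t) s
  | inf_right (s t) : Le B (inf s t) t
  | le_inf {s t v} : Le B s t → Le B s v → Le B s (inf t v)
  | sup_left (s t) : Le B s (sup s t)
  | sup_right (s t) : Le B t (sup s t)
  | sup_le {s t v} : Le B s v → Le B t v → Le B (sup s t) v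
  | distrib (s t v) : Le B (inf s (sup t v)) (sup (inf s t) (inf s v))
  | one : Le B top (D 1)
  | inf_neg (a) : Le B (inf (D a) (D (-a))) bot
  | neg_sq (b) : Le B (D (-(b ^ 2))) bot
  | add_le (a b) : Le B (D (a + b)) (sup (D a) (D b))
  | mul_le (a b) : Le B (D (a * b)) (sup (inf (D a) (D b)) (inf (D (-a)) (D (-b))))
  | le_mul (a b) : Le B (sup (inf (D a) (D b)) (inf (D (-a)) (D (-b)))) (D (a * b))

variable (B : Type u) [CommCStarAlgebra B]

instance : Preorder (SpectralTerm B) where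
  le := Le B
  le_refl := .refl
  le_trans _ _ _ := .trans

/-- The value of a formal expression in a bounded lattice. -/
def eval {B : Type u} [CommCStarAlgebra B] {X : Type*} [Lattice X] [BoundedOrder X]
    (D : selfAdjoint B → X) : SpectralTerm B → X
  | .D a => D a
  | top => ⊤
  | bot => ⊥
  | inf s t => eval D s ⊓ eval D t
  | sup s t => eval D s ⊔ eval D t

theorem eval_mono {B : Type u} [CommCStarAlgebra B] {X : Type*} [DistribLattice X]
    [BoundedOrder X] {D : selfAdjoint B → X} (h : SpectralRelations B D) :
    Monotone (eval D) := by
  intro s t hst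
  induction hst with
  | refl s => exact le_rfl
  | trans _ _ h₁ h₂ => exact h₁.trans h₂
  | le_top s => exact le_top
  | bot_le s => exact bot_le
  | inf_left s t => exact inf_le_left
  | inf_right s t => exact inf_le_right
  | le_inf _ _ h₁ h₂ => exact _root_.le_inf h₁ h₂
  | sup_left s t => exact le_sup_left
  | sup_right s t => exact le_sup_right
  | sup_le _ _ h₁ h₂ => exact _root_.sup_le h₁ h₂
  | distrib s t v => exact inf_sup_left _ _ _ |>.le
  | one => exact h.one.ge
  | inf_neg a => exact (h.inf_neg a).le
  | neg_sq b => exact (h.neg_sq b).le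
  | add_le a b => exact h.add_le a b
  | mul_le a b => exact (h.mul a b).le
  | le_mul a b => exact (h.mul a b).ge

end SpectralTerm

/-- The distributive lattice `L_B` freely generated by the symbols `D a`, for self-adjoint `a : B`,
subject to the spectral relations. -/
def SpectralLattice (B : Type u) [CommCStarAlgebra B] : Type u :=
  Antisymmetrization (SpectralTerm B) (· ≤ ·)

namespace SpectralLattice

section Basic

variable (B : Type u) [CommCStarAlgebra B]

instance : PartialOrder (SpectralLattice B) :=
  inferInstanceAs (PartialOrder (Antisymmetrization (SpectralTerm B) (· ≤ ·)))

instance : Lattice (SpectralLattice B) where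
  inf := Quotient.map₂ SpectralTerm.inf fun _ _ h _ _ k =>
    ⟨.le_inf (.trans (.inf_left _ _) h.1) (.trans (.inf_right _ _) k.1),
      .le_inf (.trans (.inf_left _ _) h.2) (.trans (.inf_right _ _) k.2)⟩
  sup := Quotient.map₂ SpectralTerm.sup fun _ _ h _ _ k =>
    ⟨.sup_le (.trans h.1 (.sup_left _ _)) (.trans k.1 (.sup_right _ _)),
      .sup_le (.trans h.2 (.sup_left _ _)) (.trans k.2 (.sup_right _ _))⟩
  inf_le_left := by rintro ⟨s⟩ ⟨t⟩; exact SpectralTerm.Le.inf_left s t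
  inf_le_right := by rintro ⟨s⟩ ⟨t⟩; exact SpectralTerm.Le.inf_right s t
  le_inf := by rintro ⟨s⟩ ⟨t⟩ ⟨v⟩ h k; exact SpectralTerm.Le.le_inf h k
  le_sup_left := by rintro ⟨s⟩ ⟨t⟩; exact SpectralTerm.Le.sup_left s t
  le_sup_right := by rintro ⟨s⟩ ⟨t⟩; exact SpectralTerm.Le.sup_right s t
  sup_le := by rintro ⟨s⟩ ⟨t⟩ ⟨v⟩ h k; exact SpectralTerm.Le.sup_le h k

instance : DistribLattice (SpectralLattice B) :=
  .ofInfSupLe (by rintro ⟨s⟩ ⟨t⟩ ⟨v⟩; exact SpectralTerm.Le.distrib s t v)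

instance : BoundedOrder (SpectralLattice B) where
  top := toAntisymmetrization _ SpectralTerm.top
  bot := toAntisymmetrization _ SpectralTerm.bot
  le_top := by rintro ⟨s⟩; exact SpectralTerm.Le.le_top s
  bot_le := by rintro ⟨s⟩; exact SpectralTerm.Le.bot_le s

end Basic

variable {B : Type u} [CommCStarAlgebra B]

/-- The generators of `L_B`. -/
def D (a : selfAdjoint B) : SpectralLattice B := toAntisymmetrization _ (.D a)

theorem relations : SpectralRelations B (D (B := B)) where
  one := le_antisymm le_top SpectralTerm.Le.one
  inf_neg a := le_antisymm (SpectralTerm.Le.inf_neg a) bot_le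
  neg_sq b := le_antisymm (SpectralTerm.Le.neg_sq b) bot_le
  add_le a b := SpectralTerm.Le.add_le a b
  mul a b := le_antisymm (SpectralTerm.Le.mul_le a b) (SpectralTerm.Le.le_mul a b)

/-- The extension to `L_B` of a map on generators that satisfies the spectral relations. -/
def lift {X : Type*} [DistribLattice X] [BoundedOrder X] (E : selfAdjoint B → X)
    (h : SpectralRelations B E) : BoundedLatticeHom (SpectralLattice B) X where
  toFun := Quotient.lift (SpectralTerm.eval E) fun _ _ hst =>
    le_antisymm (SpectralTerm.eval_mono h hst.1) (SpectralTerm.eval_mono h hst.2)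
  map_inf' := by rintro ⟨s⟩ ⟨t⟩; rfl
  map_sup' := by rintro ⟨s⟩ ⟨t⟩; rfl
  map_top' := rfl
  map_bot' := rfl

theorem lift_D {X : Type*} [DistribLattice X] [BoundedOrder X] (E : selfAdjoint B → X)
    (h : SpectralRelations B E) (a : selfAdjoint B) : lift E h (D a) = E a := rfl

theorem hom_ext {X : Type*} [DistribLattice X] [BoundedOrder X]
    {f g : BoundedLatticeHom (SpectralLattice B) X} (h : ∀ a, f (D a) = g (D a)) : f = g := by
  ext ⟨s⟩
  induction s with
  | D a => exact h a
  | top => exact (map_top f).trans (map_top g).symm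
  | bot => exact (map_bot f).trans (map_bot g).symm
  | inf s t hs ht =>
    exact (map_inf f _ _).trans ((congrArg₂ (· ⊓ ·) hs ht).trans (map_inf g _ _).symm)
  | sup s t hs ht =>
    exact (map_sup f _ _).trans ((congrArg₂ (· ⊔ ·) hs ht).trans (map_sup g _ _).symm)

end SpectralLattice

/-! ## The Gelfand spectrum of a commutative C*-algebra and the covering relation -/

/-- The least nucleus on the frame of lower sets of `L_B` that makes the embedding of `L_B`
preserve finite joins and satisfy the regularity rule. -/
noncomputable def gelfandNucleus (B : Type u) [CommCStarAlgebra B] :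
    Nucleus (LowerSet (SpectralLattice B)) :=
  sInf {n | LowerSet.Iic ⊥ ≤ n ⊥ ∧
    (∀ x y, LowerSet.Iic (x ⊔ y) ≤ n (LowerSet.Iic x ⊔ LowerSet.Iic y)) ∧
    ∀ a, LowerSet.Iic (SpectralLattice.D a) ≤
      n (⨆ (r : ℚ) (_ : 0 < r), LowerSet.Iic (SpectralLattice.D (a - (r : ℝ) • 1)))}

/-- The frame `O(Σ(B))` of the Gelfand spectrum of `B`, that is, the frame freely generated by the
symbols `D a` subject to the spectral relations and the regularity rule. It is presented as the
quotient of the free frame on the meet-semilattice `L_B` by the remaining relations. -/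
abbrev GelfandFrame (B : Type u) [CommCStarAlgebra B] : Type u :=
  Set.range (gelfandNucleus B)

/-- The canonical map `L_B → O(Σ(B))`. -/
noncomputable def toGelfandFrame {B : Type u} [CommCStarAlgebra B] (x : SpectralLattice B) :
    GelfandFrame B :=
  (gelfandNucleus B).restrict (LowerSet.Iic x)

/-- The covering relation `x ◁ U` on `L_B`. -/
def Covers {B : Type u} [CommCStarAlgebra B] (x : SpectralLattice B)
    (U : Set (SpectralLattice B)) : Prop :=
  toGelfandFrame x ≤ ⨆ y ∈ U, toGelfandFrame y

/-! ## Kripke toposes `[P, Set]` and internal frames -/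

namespace Kripke

variable {P : Type u} [PartialOrder P]

/-- The restriction `F|↑p` of a functor to the upper set `↑p`. -/
abbrev restrictUp (F : P ⥤ Type u) (p : P) : Set.Ici p ⥤ Type u :=
  (Subtype.mono_coe (· ∈ Set.Ici p)).functor ⋙ F

/-- The truncation of a subfunctor of `F|↑p` to `↑q`, for `p ≤ q`. -/
def truncate {F : P ⥤ Type u} {p q : P} (h : p ≤ q) (S : Subfunctor (restrictUp F p)) :
    Subfunctor (restrictUp F q) where
  obj r := S.obj ⟨r.1, le_trans h r.2⟩
  map {r s} i := S.map (U := ⟨r.1, le_trans h r.2⟩) (V := ⟨s.1, le_trans h s.2⟩)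
    (homOfLE (leOfHom i))

/-- The internal power object `Ω^F` at `p`, for the functor underlying an internal lattice. -/
abbrev Pow (F : P ⥤ BddLat.{u}) (p : P) : Type u :=
  Subfunctor (restrictUp (F ⋙ forget BddLat) p)

/-- `p ⊩ "j is the least upper bound of S"`, in the Kripke-Joyal semantics of `[P, Set]`, for an
internal bounded lattice `F`. -/
def IsInternalLUB (F : P ⥤ BddLat.{u}) {p : P} (S : Pow F p) (j : F.obj p) : Prop :=
  ∀ (q : P) (h : p ≤ q) (z : F.obj q), F.map (homOfLE h) j ≤ z ↔
    ∀ (r : P) (k : q ≤ r) (s : F.obj r), s ∈ S.obj ⟨r, le_trans h k⟩ → s ≤ F.map (homOfLE k) z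

/-- The subset `{x ∧ s | s ∈ S}`, formed internally. -/
def infImage (F : P ⥤ BddLat.{u}) {p : P} (x : F.obj p) (S : Pow F p) : Pow F p where
  obj r := {y | ∃ s : F.obj r.1, s ∈ S.obj r ∧ y = F.map (homOfLE r.2) x ⊓ s}
  map {r t} i := by
    rintro _ ⟨s, hs, rfl⟩
    refine ⟨_, S.map i hs, ?_⟩
    have e : homOfLE t.2 = homOfLE r.2 ≫ homOfLE (leOfHom i) := rfl
    rw [e, F.map_comp, ConcreteCategory.comp_apply]
    exact (F.map (homOfLE (leOfHom i : r.1 ≤ t.1))).hom.map_inf' _ s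

/-- An internal frame in `[P, Set]`: an internal bounded lattice (as the theory of bounded lattices
is algebraic, this is a functor `P ⥤ BddLat`) in which, internally, every subset has a least upper
bound and the infinitary distributive law holds. -/
structure IsInternalFrame (F : P ⥤ BddLat.{u}) : Prop where
  exists_lub : ∀ (p : P) (S : Pow F p), ∃ j : F.obj p, IsInternalLUB F S j
  inf_lub : ∀ (p : P) (S : Pow F p) (j x : F.obj p), IsInternalLUB F S j →
    IsInternalLUB F (infImage F x S) (x ⊓ j)

/-- The direct image of a subset under a morphism of internal lattices. -/
def image {F G : P ⥤ BddLat.{u}} (φ : F ⟶ G) {p : P} (S : Pow F p) : Pow G p where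
  obj r := {y | ∃ s ∈ S.obj r, y = φ.app r.1 s}
  map {r t} i := by
    rintro _ ⟨s, hs, rfl⟩
    refine ⟨_, S.map i hs, ?_⟩
    exact (ConcreteCategory.congr_hom (φ.naturality (homOfLE (leOfHom i))) s).symm

/-- A morphism of internal frames: a morphism of internal bounded lattices that preserves all
internal joins. -/
def IsInternalFrameHom {F G : P ⥤ BddLat.{u}} (φ : F ⟶ G) : Prop :=
  ∀ (p : P) (S : Pow F p) (j : F.obj p), IsInternalLUB F S j →
    IsInternalLUB G (image φ S) (φ.app p j)

/-- The frame `O(Alx(P))` of opens (upper sets) of `P` in the Alexandrov topology. -/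
abbrev Alx (P : Type u) [PartialOrder P] : Type u := Opens (Topology.WithUpperSet P)

/-- The basic open `↑p`. -/
def Alx.up (p : P) : Alx P :=
  ⟨Topology.WithUpperSet.ofUpperSet ⁻¹' Set.Ici p,
    Topology.IsUpperSet.isOpen_iff_isUpperSet.2 fun _ _ h k => le_trans k h⟩

/-- The lattice `F(U)` of sections of `F` over an open `U` of `Alx(P)`, that is, of compatible
families `s p ∈ F(p)` for `p ∈ U`, with the pointwise order. (This is the sheaf on `Alx(P)` that
corresponds to the functor `F`.) -/
def Sections (F : P ⥤ BddLat.{u}) (U : Alx P) : Type u :=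
  {s : ∀ p : {p : P // Topology.WithUpperSet.toUpperSet p ∈ U}, F.obj p.1 //
    ∀ p q (h : p.1 ≤ q.1), F.map (homOfLE h) (s p) = s q}

instance (F : P ⥤ BddLat.{u}) (U : Alx P) : PartialOrder (Sections F U) :=
  Subtype.partialOrder _

/-- The restriction of a global section, that is, of an element of `F(⊥)`, to an open `U`. -/
def restrictSection [OrderBot P] (F : P ⥤ BddLat.{u}) (U : Alx P) (x : F.obj ⊥) : Sections F U :=
  ⟨fun p => F.map (homOfLE (bot_le : ⊥ ≤ p.1)) x, fun p q h => by
    rw [← ConcreteCategory.comp_apply, ← F.map_comp]; rfl⟩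

/-- The top section over an open `U`. -/
def topSection (F : P ⥤ BddLat.{u}) (U : Alx P) : Sections F U :=
  ⟨fun _ => ⊤, fun _ _ h => map_top (F.map (homOfLE h)).hom⟩

/-- `f` is the inverse image map `O(Alx(P)) → F(⊥)` of the external description of the internal
frame `F`: for each open `U`, the restriction `F(⊥) → F(U)` has a left adjoint `l`, and
`f U = l 1`. -/
def IsExternalDescription [OrderBot P] (F : P ⥤ BddLat.{u}) (f : Alx P → F.obj ⊥) : Prop :=
  ∀ U : Alx P, ∃ l : Sections F U → F.obj ⊥,
    GaloisConnection l (restrictSection F U) ∧ f U = l (topSection F U)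

end Kripke

/-! ## Bohrification -/

/-- The poset `C(A)` of commutative (unital) C*-subalgebras of `A`, ordered by inclusion. -/
abbrev Context (A : Type u) [CStarAlgebra A] : Type u :=
  {C : StarSubalgebra ℂ A // IsClosed (C : Set A) ∧ ∀ a ∈ C, ∀ b ∈ C, a * b = b * a}

namespace Bohr

variable (A : Type u) [CStarAlgebra A]

noncomputable instance (C : Context A) : CommCStarAlgebra C.1 where
  __ := StarSubalgebra.cstarAlgebra C.1 (h_closed := C.2.1)
  mul_comm a b := Subtype.ext (C.2.2 a a.2 b b.2)

/-- The least context `ℂ`, the scalar multiples of the unit. -/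
instance : OrderBot (Context A) where
  bot := ⟨⊥, by
      have h : ((⊥ : StarSubalgebra ℂ A) : Set A) =
          (LinearMap.range (Algebra.linearMap ℂ A) : Set A) := by
        ext x; simp
      rw [h]; exact Submodule.closed_of_finiteDimensional _,
    by
      rintro a ha b -
      obtain ⟨z, rfl⟩ := StarSubalgebra.mem_bot.1 ha
      exact Algebra.commutes z b⟩
  bot_le C := bot_le (a := C.1)

variable {A} in
/-- The inclusion `C_sa → D_sa` of self-adjoint parts, for `C ⊆ D`. -/
def inclusionSA {C D : Context A} (h : C ≤ D) (a : selfAdjoint C.1) : selfAdjoint D.1 :=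
  ⟨StarSubalgebra.inclusion h a.1, by
    rw [selfAdjoint.mem_iff, ← map_star, a.2.star_eq]⟩

/-- The self-adjoint part of the Bohrification of `A`: the functor `C ↦ C_sa`, with the inclusions
as restriction maps. -/
noncomputable def selfAdjointFunctor : Context A ⥤ Type u where
  obj C := selfAdjoint C.1
  map h := ↾(inclusionSA (leOfHom h))

variable {A} in
theorem relations_inclusionSA {C D : Context A} (h : C ≤ D) :
    SpectralRelations C.1 fun a : selfAdjoint C.1 => SpectralLattice.D (inclusionSA h a) where
  one := SpectralLattice.relations.one
  inf_neg a := SpectralLattice.relations.inf_neg (inclusionSA h a)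
  neg_sq b := SpectralLattice.relations.neg_sq (inclusionSA h b)
  add_le a b := SpectralLattice.relations.add_le (inclusionSA h a) (inclusionSA h b)
  mul a b := SpectralLattice.relations.mul (inclusionSA h a) (inclusionSA h b)

/-- The lattice `L_A` of the Bohrification: the functor `C ↦ L_C`, which maps each generator `D c`
of `L_C` to the same generator of `L_D`, for `C ⊆ D`. -/
noncomputable def spectralLattice : Context A ⥤ BddDistLat.{u} where
  obj C := BddDistLat.of (SpectralLattice C.1)
  map h := BddDistLat.ofHom (SpectralLattice.lift _ (relations_inclusionSA (leOfHom h)))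
  map_id _ := BddDistLat.hom_ext (SpectralLattice.hom_ext fun _ => rfl)
  map_comp _ _ := BddDistLat.hom_ext (SpectralLattice.hom_ext fun _ => rfl)

/-- The functor to sets underlying the internal lattice `L_A`. -/
noncomputable abbrev spectralLatticeSet : Context A ⥤ Type u := spectralLattice A ⋙ forget BddDistLat

/-- The generators of the internal lattice `L_A`. -/
noncomputable def generators : selfAdjointFunctor A ⟶ spectralLattice A ⋙ forget BddDistLat where
  app C := ↾(fun a : selfAdjoint C.1 => (SpectralLattice.D a : SpectralLattice C.1))

/-- In the topos `[C(A), Set]`, `L` is the internal distributive lattice freely generated by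
symbols `D a`, for `a` in the self-adjoint part of the Bohrification, subject to the spectral
relations. -/
structure IsSpectralLattice (L : Context A ⥤ BddDistLat.{u})
    (D : selfAdjointFunctor A ⟶ L ⋙ forget BddDistLat) : Prop where
  relations : ∀ C : Context A, SpectralRelations C.1 (X := L.obj C) (D.app C)
  universal : ∀ (M : Context A ⥤ BddDistLat.{u})
    (E : selfAdjointFunctor A ⟶ M ⋙ forget BddDistLat),
    (∀ C : Context A, SpectralRelations C.1 (X := M.obj C) (E.app C)) →
    ∃! φ : L ⟶ M, D ≫ Functor.whiskerRight φ (forget BddDistLat) = E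

/-- In the topos `[C(A), Set]`, `O` is the frame of the Gelfand spectrum of the Bohrification of
`A`: the internal frame freely generated by symbols `D a`, for `a` in the self-adjoint part of the
Bohrification, subject to the spectral relations and the regularity rule. -/
structure IsGelfandSpectrum (O : Context A ⥤ BddLat.{u})
    (D : selfAdjointFunctor A ⟶ O ⋙ forget BddLat) : Prop where
  isFrame : Kripke.IsInternalFrame O
  relations : ∀ C : Context A, GelfandRelations C.1 (X := O.obj C) (D.app C)
  universal : ∀ (G : Context A ⥤ BddLat.{u}) (E : selfAdjointFunctor A ⟶ G ⋙ forget BddLat),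
    Kripke.IsInternalFrame G →
    (∀ C : Context A, GelfandRelations C.1 (X := G.obj C) (E.app C)) →
    ∃! φ : O ⟶ G, Kripke.IsInternalFrameHom φ ∧
      D ≫ Functor.whiskerRight φ (forget BddLat) = E

/-- The subfunctors `U` of `L_A|↑C` that are closed under the covering relations `◁_D` of `L_D`,
for `D ⊇ C`, ordered by inclusion. -/
abbrev ClosedSubfunctor (C : Context A) : Type u :=
  {U : Subfunctor (Kripke.restrictUp (spectralLatticeSet A) C) //
    ∀ (D : Set.Ici C) (d : SpectralLattice D.1.1), Covers d (U.obj D) → d ∈ U.obj D}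

/-- The subfunctors `U` of `L_A` that are closed under the covering relations `◁_C` of `L_C`,
ordered by inclusion. -/
abbrev GlobalClosedSubfunctor : Type u :=
  {U : Subfunctor (spectralLatticeSet A) //
    ∀ (C : Context A) (c : SpectralLattice C.1), Covers c (U.obj C) → c ∈ U.obj C}

end Bohr

/-! The frame of one commutative algebra is a quotient of the lower sets of `L_B` by a nucleus, so
its elements amount to the subsets of `L_B` closed under `Covers`. The internal spectrum is the same
construction carried out over all contexts at once: the functor `closedFunctor` of closed
subfunctors is shown directly to have the universal property.

The engine is `Covers.map_le`: a lattice homomorphism on `L_B` that respects regularity, into a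
lattice whose joins satisfy the frame law, sends covers to joins. Applied to `L_C → L_E → O(Σ(E))`,
it shows that restriction preserves covers (`Covers.restrictLattice`). Hence the stagewise closure
of a subfunctor is again a subfunctor, and internal joins are unions followed by closure; the frame
law comes from `Covers.inf`.

Given generators in an internal frame `G`, they extend to lattice homomorphisms `L_C → G(C)`, and a
closed subfunctor goes to the internal join of the images of its elements. Covers are respected by
`Covers.map_le`, finite meets by the internal distributive law, and uniqueness holds because every
closed subfunctor is the internal join of principal ones. Any other spectrum is isomorphic to this
one, so its description is obtained by transport.

The left adjoint in the external description extends a section over `V` by the empty set outside `V`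
and then closes. That the closure of the empty set is `{⊥}` is the analytic point (`Covers.eq_bot`):
every element of `L_B` is some `D (p ^ 2)`, each character is a point of the spectrum, and a
self-adjoint element killed by all characters is zero. -/

/-- Arbitrary subsets of a lattice have least upper bounds, and meets distribute over them. -/
def HasFrameJoins (X : Type*) [Lattice X] : Prop :=
  ∀ W : Set X, ∃ j, IsLUB W j ∧ ∀ x, IsLUB ((x ⊓ ·) '' W) (x ⊓ j)

theorem Order.Frame.hasFrameJoins (X : Type*) [Order.Frame X] : HasFrameJoins X := fun W =>
  ⟨sSup W, isLUB_sSup W, fun x => by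
    rw [inf_sSup_eq, ← sSup_image]
    exact isLUB_sSup _⟩

namespace HasFrameJoins

variable {X : Type*} [Lattice X]

/-- The first two hypotheses mean `x ≤ ⋁ U` and `y ≤ ⋁ V`, phrased by upper bounds so that no join
has to be chosen. The frame law is then used once in each variable. -/
theorem inf_le_of_forall (hX : HasFrameJoins X) {U V : Set X} {x y z : X}
    (hx : ∀ b, (∀ u ∈ U, u ≤ b) → x ≤ b) (hy : ∀ b, (∀ v ∈ V, v ≤ b) → y ≤ b)
    (h : ∀ u ∈ U, ∀ v ∈ V, u ⊓ v ≤ z) : x ⊓ y ≤ z := by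
  obtain ⟨a, ha, ha'⟩ := hX U
  obtain ⟨b, hb, hb'⟩ := hX V
  refine (inf_le_inf (hx a fun u hu => ha.1 hu) (hy b fun v hv => hb.1 hv)).trans ?_
  refine (hb' a).2 ?_
  rintro _ ⟨v, hv, rfl⟩
  change a ⊓ v ≤ z
  rw [inf_comm]
  refine (ha' v).2 ?_
  rintro _ ⟨u, hu, rfl⟩
  change v ⊓ u ≤ z
  rw [inf_comm]
  exact h u hu v hv

theorem inf_sup_le (hX : HasFrameJoins X) (x y z : X) : x ⊓ (y ⊔ z) ≤ (x ⊓ y) ⊔ (x ⊓ z) := by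
  refine hX.inf_le_of_forall (U := {x}) (V := {y, z}) (fun b h => h x rfl)
    (fun b h => sup_le (h y (by simp)) (h z (by simp))) ?_
  rintro _ rfl v (rfl | rfl)
  · exact le_sup_left
  · exact le_sup_right

end HasFrameJoins

/-! ### The covering relation of a commutative algebra. -/

section Covers

variable {B : Type u} [CommCStarAlgebra B]

theorem toGelfandFrame_le_iff {x : SpectralLattice B} {I : LowerSet (SpectralLattice B)} :
    toGelfandFrame x ≤ (gelfandNucleus B).restrict I ↔ x ∈ gelfandNucleus B I := by
  refine ((gelfandNucleus B).giRestrict.gc _ _).trans ?_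
  exact LowerSet.Iic_le

theorem covers_iff {x : SpectralLattice B} {U : Set (SpectralLattice B)} :
    Covers x U ↔ x ∈ gelfandNucleus B (⨆ y ∈ U, LowerSet.Iic y) := by
  rw [← toGelfandFrame_le_iff, map_iSup₂]
  rfl

/-- An infimum of nuclei is computed pointwise, so the defining inequalities pass to the least
nucleus. -/
theorem gelfandNucleus_spec :
    LowerSet.Iic ⊥ ≤ gelfandNucleus B ⊥ ∧
    (∀ x y, LowerSet.Iic (x ⊔ y) ≤ gelfandNucleus B (LowerSet.Iic x ⊔ LowerSet.Iic y)) ∧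
    ∀ a, LowerSet.Iic (SpectralLattice.D a) ≤ gelfandNucleus B
      (⨆ (r : ℚ) (_ : 0 < r), LowerSet.Iic (SpectralLattice.D (a - (r : ℝ) • 1))) := by
  refine ⟨?_, fun x y => ?_, fun a => ?_⟩ <;>
    simp only [gelfandNucleus, Nucleus.sInf_apply, le_iInf_iff] <;> intro n hn
  · exact hn.1
  · exact hn.2.1 x y
  · exact hn.2.2 a

theorem toGelfandFrame_mono : Monotone (toGelfandFrame (B := B)) := fun _ _ h =>
  OrderHomClass.mono (gelfandNucleus B).restrict (LowerSet.Iic_le.2 h)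

/-- The canonical map from `L_B` to the frame of the spectrum, as a lattice homomorphism. -/
noncomputable def gelfandHom (B : Type u) [CommCStarAlgebra B] :
    BoundedLatticeHom (SpectralLattice B) (GelfandFrame B) where
  toFun := toGelfandFrame
  map_sup' x y := by
    refine le_antisymm ?_ (sup_le (toGelfandFrame_mono le_sup_left)
      (toGelfandFrame_mono le_sup_right))
    change _ ≤ (gelfandNucleus B).restrict _ ⊔ (gelfandNucleus B).restrict _
    rw [← map_sup, toGelfandFrame_le_iff]
    exact LowerSet.Iic_le.1 (gelfandNucleus_spec.2.1 x y)
  map_inf' x y := by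
    change _ = (gelfandNucleus B).restrict _ ⊓ (gelfandNucleus B).restrict _
    rw [← map_inf, ← LowerSet.Iic_inf]
    rfl
  map_top' := by
    refine top_le_iff.1 ?_
    rw [← map_top (gelfandNucleus B).restrict, ← LowerSet.Iic_top]
    rfl
  map_bot' := by
    refine le_bot_iff.1 ?_
    change toGelfandFrame _ ≤ _
    rw [← map_bot (gelfandNucleus B).restrict, toGelfandFrame_le_iff]
    exact LowerSet.Iic_le.1 gelfandNucleus_spec.1

theorem gelfandHom_regular (a : selfAdjoint B) (z : GelfandFrame B)
    (h : ∀ r : ℚ, 0 < r → gelfandHom B (SpectralLattice.D (a - (r : ℝ) • 1)) ≤ z) :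
    gelfandHom B (SpectralLattice.D a) ≤ z := by
  have h₁ := LowerSet.Iic_le.1 (gelfandNucleus_spec.2.2 a)
  rw [← toGelfandFrame_le_iff, map_iSup₂] at h₁
  exact h₁.trans (iSup₂_le h)

theorem gelfandHom_le_iff_covers {x : SpectralLattice B} {U : Set (SpectralLattice B)} :
    Covers x U ↔ ∀ z, (∀ y ∈ U, gelfandHom B y ≤ z) → gelfandHom B x ≤ z :=
  ⟨fun h _ hz => h.trans (iSup₂_le hz), fun h => h _ fun y hy => le_iSup₂_of_le y hy le_rfl⟩

/-- A regular lattice homomorphism on `L_B` sends covers to joins. -/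
theorem Covers.map_le {X : Type*} [Lattice X] [BoundedOrder X] (hX : HasFrameJoins X)
    (ε : BoundedLatticeHom (SpectralLattice B) X)
    (hε : ∀ a z, (∀ r : ℚ, 0 < r → ε (SpectralLattice.D (a - (r : ℝ) • 1)) ≤ z) →
      ε (SpectralLattice.D a) ≤ z)
    {x : SpectralLattice B} {U : Set (SpectralLattice B)} (hx : Covers x U) {z : X}
    (hz : ∀ y ∈ U, ε y ≤ z) : ε x ≤ z := by
  -- This nucleus sends `I` to the set of all `x` with `ε x ≤ ⋁ ε(I)`. It satisfies the three
  -- defining conditions of `gelfandNucleus`, which therefore lies below it.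
  let n : Nucleus (LowerSet (SpectralLattice B)) :=
    { toFun I :=
        { carrier := {x | ∀ z, (∀ y ∈ I, ε y ≤ z) → ε x ≤ z}
          lower' := fun a b hab ha z hz => (OrderHomClass.mono ε hab).trans (ha z hz) }
      map_inf' I J := by
        refine le_antisymm (le_inf (fun x hx z hz => hx z fun y hy => hz y hy.1)
          fun x hx z hz => hx z fun y hy => hz y hy.2) ?_
        rintro x ⟨hI, hJ⟩ z hz
        rw [← inf_idem (ε x)]
        refine hX.inf_le_of_forall (U := ε '' I) (V := ε '' J)
          (fun b hb => hI b fun y hy => hb _ ⟨y, hy, rfl⟩)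
          (fun b hb => hJ b fun y hy => hb _ ⟨y, hy, rfl⟩) ?_
        rintro _ ⟨u, hu, rfl⟩ _ ⟨v, hv, rfl⟩
        rw [← map_inf]
        exact hz _ ⟨I.lower inf_le_left hu, J.lower inf_le_right hv⟩
      idempotent' I x hx z hz := hx z fun y hy => hy z hz
      le_apply' I x hx z hz := hz x hx }
  have hn : gelfandNucleus B ≤ n := by
    refine sInf_le ⟨?_, fun x y => ?_, fun a => ?_⟩ <;> rw [LowerSet.Iic_le]
    · intro z _
      rw [map_bot]
      exact bot_le
    · intro z hz
      rw [map_sup]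
      exact sup_le (hz x (Or.inl (le_refl x))) (hz y (Or.inr (le_refl y)))
    · intro z hz
      refine hε a z fun r hr => hz _ ?_
      simp only [LowerSet.mem_iSup_iff]
      exact ⟨r, hr, le_refl (SpectralLattice.D (a - (r : ℝ) • 1))⟩
  refine hn _ (covers_iff.1 hx) z fun y hy => ?_
  simp only [LowerSet.mem_iSup_iff] at hy
  obtain ⟨w, hw, hyw⟩ := hy
  exact (OrderHomClass.mono ε hyw).trans (hz w hw)

theorem Covers.of_mem {x : SpectralLattice B} {U : Set (SpectralLattice B)} (hx : x ∈ U) :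
    Covers x U :=
  gelfandHom_le_iff_covers.2 fun _ hz => hz x hx

theorem Covers.trans {x : SpectralLattice B} {U V : Set (SpectralLattice B)} (hx : Covers x U)
    (h : ∀ y ∈ U, Covers y V) : Covers x V :=
  gelfandHom_le_iff_covers.2 fun z hz => gelfandHom_le_iff_covers.1 hx z fun y hy =>
    gelfandHom_le_iff_covers.1 (h y hy) z hz

theorem Covers.mono {x : SpectralLattice B} {U V : Set (SpectralLattice B)} (hx : Covers x U)
    (h : U ⊆ V) : Covers x V :=
  hx.trans fun _ hy => .of_mem (h hy)

theorem Covers.of_le {x y : SpectralLattice B} (h : x ≤ y) : Covers x {y} :=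
  gelfandHom_le_iff_covers.2 fun _ hz => (OrderHomClass.mono (gelfandHom B) h).trans (hz y rfl)

theorem Covers.bot (U : Set (SpectralLattice B)) : Covers ⊥ U :=
  gelfandHom_le_iff_covers.2 fun z _ => by rw [map_bot]; exact bot_le

theorem Covers.sup (x y : SpectralLattice B) : Covers (x ⊔ y) {x, y} :=
  gelfandHom_le_iff_covers.2 fun z hz => by
    rw [map_sup]
    exact sup_le (hz x (by simp)) (hz y (by simp))

theorem Covers.regular (a : selfAdjoint B) :
    Covers (SpectralLattice.D a)
      {y | ∃ r : ℚ, 0 < r ∧ y = SpectralLattice.D (a - (r : ℝ) • 1)} :=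
  gelfandHom_le_iff_covers.2 fun z hz => gelfandHom_regular a z fun r hr => hz _ ⟨r, hr, rfl⟩

/-- Distributivity of the frame `O(Σ(B))`, read as a rule for covers. It yields both the external
and the internal frame law for closed subfunctors. -/
theorem Covers.inf {x y w : SpectralLattice B} {U V W : Set (SpectralLattice B)}
    (hx : Covers x U) (hy : Covers y V) (hwx : w ≤ x) (hwy : w ≤ y)
    (h : ∀ u ∈ U, ∀ v ∈ V, u ⊓ v ∈ W) : Covers w W :=
  gelfandHom_le_iff_covers.2 fun z hz => by
    rw [gelfandHom_le_iff_covers] at hx hy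
    refine (OrderHomClass.mono (gelfandHom B) (le_inf hwx hwy)).trans ?_
    rw [map_inf]
    refine (Order.Frame.hasFrameJoins (GelfandFrame B)).inf_le_of_forall
      (U := gelfandHom B '' U) (V := gelfandHom B '' V)
      (fun b hb => hx b fun u hu => hb _ ⟨u, hu, rfl⟩)
      (fun b hb => hy b fun v hv => hb _ ⟨v, hv, rfl⟩) ?_
    rintro _ ⟨u, hu, rfl⟩ _ ⟨v, hv, rfl⟩
    rw [← map_inf]
    exact hz _ (h u hu v hv)

end Covers

/-! ### Characters, and why only the least element has an empty cover. -/

section Zero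

variable {B : Type u} [CommCStarAlgebra B]

namespace SpectralLattice

/-- Functional calculus: `p` and `q` are the square roots of the positive and negative parts of `a`.
The real square root vanishes on negative numbers, so no truncation is needed. -/
theorem exists_sq_sub_sq (a : selfAdjoint B) :
    ∃ p q : selfAdjoint B, a = p ^ 2 + -(q ^ 2) ∧ p * q = 0 := by
  have ha : IsSelfAdjoint (a : B) := a.2
  let f : ℝ → ℝ := fun x => √x
  let g : ℝ → ℝ := fun x => √(-x)
  have hf : Continuous f := Real.continuous_sqrt
  have hg : Continuous g := Real.continuous_sqrt.comp continuous_neg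
  refine ⟨⟨cfc f (a : B), cfc_predicate f _⟩, ⟨cfc g (a : B), cfc_predicate g _⟩, ?_, ?_⟩
  · ext
    have h : cfc (fun x => f x ^ 2 - g x ^ 2) (a : B) = a := by
      conv_rhs => rw [← cfc_id ℝ (a : B)]
      refine cfc_congr fun x _ => ?_
      rcases le_total 0 x with hx | hx
      · simp [f, g, Real.sq_sqrt hx, Real.sqrt_eq_zero_of_nonpos (neg_nonpos.2 hx)]
      · simp [f, g, Real.sq_sqrt (neg_nonneg.2 hx), Real.sqrt_eq_zero_of_nonpos hx]
    rw [cfc_sub _ _ _ (by fun_prop) (by fun_prop), cfc_pow _ _ _ (by fun_prop),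
      cfc_pow _ _ _ (by fun_prop)] at h
    simpa [sub_eq_add_neg] using h.symm
  · ext
    have h : cfc (fun x => f x * g x) (a : B) = 0 := by
      rw [← cfc_zero ℝ (a : B)]
      refine cfc_congr fun x _ => ?_
      rcases le_total 0 x with hx | hx
      · simp [f, g, Real.sqrt_eq_zero_of_nonpos (neg_nonpos.2 hx)]
      · simp [f, g, Real.sqrt_eq_zero_of_nonpos hx]
    rw [cfc_mul _ _ _ (by fun_prop) (by fun_prop)] at h
    simpa using h

theorem D_sq_mul (p a : selfAdjoint B) : D (p ^ 2 * a) = D (p ^ 2) ⊓ D a := by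
  rw [relations.mul, relations.neg_sq, bot_inf_eq, sup_bot_eq]

theorem D_sq_add_sq (p q : selfAdjoint B) : D (p ^ 2 + q ^ 2) = D (p ^ 2) ⊔ D (q ^ 2) := by
  have key (p q : selfAdjoint B) : D (p ^ 2) ≤ D (p ^ 2 + q ^ 2) := by
    have h := relations.add_le (p ^ 2 + q ^ 2) (-(q ^ 2))
    rwa [add_neg_cancel_right, relations.neg_sq, sup_bot_eq] at h
  refine le_antisymm (relations.add_le _ _) (sup_le (key p q) ?_)
  rw [add_comm]
  exact key q p

/-- Write `a = p² - q²` with `pq = 0`. Subadditivity and `D (-(q ^ 2)) = ⊥` give one inequality. For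
the other, `p² a = p² p²`, so `D_sq_mul` turns this equation into `D (p ^ 2) ⊓ D a = D (p ^ 2)`. -/
theorem exists_D_eq_D_sq (a : selfAdjoint B) : ∃ p : selfAdjoint B, D a = D (p ^ 2) := by
  obtain ⟨p, q, ha, hpq⟩ := exists_sq_sub_sq a
  refine ⟨p, le_antisymm ?_ ?_⟩
  · have h := relations.add_le (p ^ 2) (-(q ^ 2))
    rwa [relations.neg_sq, sup_bot_eq, ← ha] at h
  · have h : p ^ 2 * a = p ^ 2 * p ^ 2 := by
      rw [ha, mul_add, mul_neg, ← mul_pow, ← mul_pow, hpq]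
      simp
    have h' := D_sq_mul p a
    rw [h, D_sq_mul, inf_idem] at h'
    exact inf_eq_left.1 h'.symm

/-- On squares, meets are products and joins are sums, so the generators of this form already
exhaust the lattice. -/
theorem exists_eq_D_sq (x : SpectralLattice B) : ∃ p : selfAdjoint B, x = D (p ^ 2) := by
  obtain ⟨s⟩ := x
  induction s with
  | D a => exact exists_D_eq_D_sq a
  | top => exact ⟨1, by rw [one_pow]; exact relations.one.symm⟩
  | bot =>
    refine ⟨0, ?_⟩
    have h := relations.neg_sq (0 : selfAdjoint B)
    rw [zero_pow two_ne_zero, neg_zero] at h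
    rw [zero_pow two_ne_zero]
    exact h.symm
  | inf s t hs ht =>
    obtain ⟨p, hp⟩ := hs
    obtain ⟨q, hq⟩ := ht
    refine ⟨p * q, ?_⟩
    rw [mul_pow, D_sq_mul, ← hp, ← hq]
    rfl
  | sup s t hs ht =>
    obtain ⟨p, hp⟩ := hs
    obtain ⟨q, hq⟩ := ht
    obtain ⟨c, hc⟩ := exists_D_eq_D_sq (p ^ 2 + q ^ 2)
    refine ⟨c, ?_⟩
    rw [← hc, D_sq_add_sq, ← hp, ← hq]
    rfl

end SpectralLattice

theorem WeakDual.CharacterSpace.ofReal_re_selfAdjoint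
    (χ : WeakDual.characterSpace ℂ B) (a : selfAdjoint B) : ((χ (a : B)).re : ℂ) = χ (a : B) := by
  have h : star (χ (a : B)) = χ (a : B) := by rw [← map_star, a.2.star_eq]
  exact Complex.conj_eq_iff_re.1 h

/-- A character is a point of the spectrum: it induces a homomorphism from `L_B` to the frame
`Prop`. -/
theorem spectralRelations_characterSpace (χ : WeakDual.characterSpace ℂ B) :
    SpectralRelations B fun a : selfAdjoint B => 0 < (χ (a : B)).re where
  one := by simp
  inf_neg a := by
    simp only [NegMemClass.coe_neg, map_neg, Complex.neg_re]
    refine eq_bot_iff.2 ?_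
    rintro ⟨h, h'⟩
    linarith
  neg_sq b := by
    rw [eq_bot_iff]
    intro h
    have e : χ ((-(b ^ 2) : selfAdjoint B) : B) = ((-(χ (b : B)).re ^ 2 : ℝ) : ℂ) := by
      push_cast
      rw [WeakDual.CharacterSpace.ofReal_re_selfAdjoint]
      simp
    rw [e, Complex.ofReal_re] at h
    nlinarith [sq_nonneg (χ (b : B)).re]
  add_le a b := by
    intro h
    simp only [AddMemClass.coe_add, map_add, Complex.add_re] at h
    change _ ∨ _
    by_contra! hc
    linarith [hc.1, hc.2]
  mul a b := by
    have e : χ ((a * b : selfAdjoint B) : B) = (((χ (a : B)).re * (χ (b : B)).re : ℝ) : ℂ) := by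
      push_cast
      rw [WeakDual.CharacterSpace.ofReal_re_selfAdjoint,
        WeakDual.CharacterSpace.ofReal_re_selfAdjoint]
      simp
    rw [e, Complex.ofReal_re, mul_pos_iff]
    simp

/-- Every character sends the empty cover to an empty join in `Prop`, so `0 < χ(p)²` fails for all
`χ` when `x = D (p ^ 2)`. Injectivity of the Gelfand transform then gives `p = 0`. -/
theorem Covers.eq_bot {x : SpectralLattice B} (hx : Covers x ∅) : x = ⊥ := by
  obtain ⟨p, rfl⟩ := SpectralLattice.exists_eq_D_sq x
  have h (χ : WeakDual.characterSpace ℂ B) : χ (p : B) = 0 := by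
    have := hx.map_le (Order.Frame.hasFrameJoins Prop)
      (SpectralLattice.lift _ (spectralRelations_characterSpace χ)) (fun a z h ha => by
        rw [SpectralLattice.lift_D] at ha
        -- Regularity of the point: a rational `r` with `0 < r < χ(a)` makes `χ(a - r)` positive.
        obtain ⟨r, hr, hra⟩ := exists_rat_btwn ha
        refine h r (by exact_mod_cast hr) ?_
        rw [SpectralLattice.lift_D]
        have e : χ ((r : ℝ) • (1 : B)) = ((r : ℝ) : ℂ) := by
          rw [← Complex.coe_smul, map_smul, map_one, smul_eq_mul, mul_one]
        simpa [e] using hra) (z := False)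
      (by simp)
    rw [SpectralLattice.lift_D] at this
    have e : χ ((p ^ 2 : selfAdjoint B) : B) = (((χ (p : B)).re ^ 2 : ℝ) : ℂ) := by
      push_cast
      rw [WeakDual.CharacterSpace.ofReal_re_selfAdjoint]
      simp
    rw [e, Complex.ofReal_re] at this
    rw [← WeakDual.CharacterSpace.ofReal_re_selfAdjoint, Complex.ofReal_eq_zero]
    by_contra hne
    exact this (by positivity)
  have hp : p = 0 := by
    ext
    refine (gelfandTransform_bijective B).1 ?_
    ext χ
    simpa using h χ
  have h := SpectralLattice.relations.neg_sq (0 : selfAdjoint B)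
  rw [zero_pow two_ne_zero, neg_zero] at h
  rw [hp, zero_pow two_ne_zero, h]

end Zero

/-! ### Internal least upper bounds and internal frames. -/

namespace Kripke

variable {P : Type u} [PartialOrder P] {F G H : P ⥤ BddLat.{u}}

theorem map_homOfLE_refl (F : P ⥤ BddLat.{u}) {p : P} (h : p ≤ p) (x : F.obj p) :
    F.map (homOfLE h) x = x := by
  have e : homOfLE h = 𝟙 p := rfl
  rw [e, F.map_id, ConcreteCategory.id_apply]

theorem map_homOfLE_trans (F : P ⥤ BddLat.{u}) {p q r : P} (h : p ≤ q) (k : q ≤ r) (x : F.obj p) :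
    F.map (homOfLE k) (F.map (homOfLE h) x) = F.map (homOfLE (h.trans k)) x := by
  rw [← ConcreteCategory.comp_apply, ← F.map_comp]
  rfl

theorem map_mono (F : P ⥤ BddLat.{u}) {p q : P} (i : p ⟶ q) {x y : F.obj p} (h : x ≤ y) :
    F.map i x ≤ F.map i y :=
  OrderHomClass.mono (F.map i).hom h

theorem app_mono (φ : F ⟶ G) {p : P} {x y : F.obj p} (h : x ≤ y) : φ.app p x ≤ φ.app p y :=
  OrderHomClass.mono (φ.app p).hom h

theorem app_naturality (φ : F ⟶ G) {p q : P} (i : p ⟶ q) (x : F.obj p) :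
    φ.app q (F.map i x) = G.map i (φ.app p x) :=
  ConcreteCategory.congr_hom (φ.naturality i) x

namespace IsInternalLUB

variable {p : P} {S : Pow F p} {j : F.obj p}

theorem le_iff (hj : IsInternalLUB F S j) {z : F.obj p} :
    j ≤ z ↔ ∀ (r : P) (k : p ≤ r) (s : F.obj r), s ∈ S.obj ⟨r, k⟩ → s ≤ F.map (homOfLE k) z := by
  have h := hj p le_rfl z
  rwa [map_homOfLE_refl] at h

theorem unique {j' : F.obj p} (hj : IsInternalLUB F S j) (hj' : IsInternalLUB F S j') : j = j' :=
  le_antisymm (hj.le_iff.2 (hj'.le_iff.1 le_rfl)) (hj'.le_iff.2 (hj.le_iff.1 le_rfl))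

theorem le (hj : IsInternalLUB F S j) {r : P} (k : p ≤ r) {s : F.obj r} (hs : s ∈ S.obj ⟨r, k⟩) :
    s ≤ F.map (homOfLE k) j :=
  hj.le_iff.1 le_rfl r k s hs

/-- The stability of least upper bounds under restriction reduces the definition to one stage. -/
theorem of_le_iff {S : Pow F p}
    (h : ∀ (q : P) (h : p ≤ q) (r : P) (k : q ≤ r) (s : F.obj r), s ∈ S.obj ⟨r, h.trans k⟩ →
      s ≤ F.map (homOfLE (h.trans k)) j)
    (h' : ∀ (q : P) (h : p ≤ q) (z : F.obj q),
      (∀ (r : P) (k : q ≤ r) (s : F.obj r), s ∈ S.obj ⟨r, h.trans k⟩ → s ≤ F.map (homOfLE k) z) →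
      F.map (homOfLE h) j ≤ z) : IsInternalLUB F S j := fun q hq z =>
  ⟨fun hz r k s hs => (h q hq r k s hs).trans (by
    rw [← map_homOfLE_trans F hq k]
    exact map_mono F _ hz), h' q hq z⟩

end IsInternalLUB

/-- The stages of an internal frame have all joins, and meets distribute over them. -/
theorem IsInternalFrame.hasFrameJoins (hF : IsInternalFrame F) (p : P) :
    HasFrameJoins (F.obj p) := by
  intro W
  -- The internal subset generated by `W`: its internal join is the ordinary join of `W` at stage
  -- `p`.
  let S : Pow F p :=
    { obj r := {y | ∃ w ∈ W, y = F.map (homOfLE r.2) w}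
      map {r t} i := by
        rintro _ ⟨w, hw, rfl⟩
        exact ⟨w, hw, map_homOfLE_trans F r.2 (leOfHom i) w⟩ }
  obtain ⟨j, hj⟩ := hF.exists_lub p S
  refine ⟨j, ⟨fun w hw => ?_, fun z hz => ?_⟩, fun x => ⟨?_, fun z hz => ?_⟩⟩
  · have h := hj.le (r := p) le_rfl (s := w) ⟨w, hw, (map_homOfLE_refl F _ w).symm⟩
    rwa [map_homOfLE_refl] at h
  · refine hj.le_iff.2 ?_
    rintro r k _ ⟨w, hw, rfl⟩
    exact map_mono F _ (hz hw)
  · rintro _ ⟨w, hw, rfl⟩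
    have h := hj.le (r := p) le_rfl (s := w) ⟨w, hw, (map_homOfLE_refl F _ w).symm⟩
    rw [map_homOfLE_refl] at h
    exact inf_le_inf_left x h
  · refine (hF.inf_lub p S j x hj).le_iff.2 ?_
    rintro r k _ ⟨_, ⟨w, hw, rfl⟩, rfl⟩
    refine le_trans (le_of_eq ?_) (map_mono F _ (hz ⟨w, hw, rfl⟩))
    exact ((F.map (homOfLE k)).hom.map_inf' x w).symm

theorem IsInternalFrameHom.id (F : P ⥤ BddLat.{u}) : IsInternalFrameHom (𝟙 F) := by
  intro p S j hj
  have e : image (𝟙 F) S = S := by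
    ext r y
    constructor
    · rintro ⟨s, hs, rfl⟩
      exact hs
    · exact fun hy => ⟨y, hy, rfl⟩
  rw [e]
  exact hj

theorem IsInternalFrameHom.comp {φ : F ⟶ G} {ψ : G ⟶ H} (hφ : IsInternalFrameHom φ)
    (hψ : IsInternalFrameHom ψ) : IsInternalFrameHom (φ ≫ ψ) := by
  intro p S j hj
  have e : image (φ ≫ ψ) S = image ψ (image φ S) := by
    ext r y
    constructor
    · rintro ⟨s, hs, rfl⟩
      exact ⟨_, ⟨s, hs, rfl⟩, rfl⟩
    · rintro ⟨_, ⟨s, hs, rfl⟩, rfl⟩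
      exact ⟨s, hs, rfl⟩
  rw [e]
  exact hψ p _ _ (hφ p S j hj)

end Kripke

/-! ### The internal frame of closed subfunctors. -/

namespace Bohr

open Kripke

variable {A : Type u} [CStarAlgebra A]

/-- The restriction map `L_C → L_E`. -/
noncomputable def restrictLattice {C E : Context A} (h : C ≤ E) :
    BoundedLatticeHom (SpectralLattice C.1) (SpectralLattice E.1) :=
  SpectralLattice.lift _ (relations_inclusionSA h)

theorem restrictLattice_refl {C : Context A} (h : C ≤ C) (x : SpectralLattice C.1) :
    restrictLattice h x = x :=
  DFunLike.congr_fun (SpectralLattice.hom_ext (g := BoundedLatticeHom.id _) fun _ => rfl :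
    restrictLattice h = _) x

theorem restrictLattice_trans {C E E' : Context A} (h : C ≤ E) (k : E ≤ E')
    (x : SpectralLattice C.1) :
    restrictLattice k (restrictLattice h x) = restrictLattice (h.trans k) x :=
  DFunLike.congr_fun (SpectralLattice.hom_ext fun _ => rfl :
    (restrictLattice k).comp (restrictLattice h) = restrictLattice (h.trans k)) x

/-- The composite `L_C → L_E → O(Σ(E))` respects regularity, because the inclusion of contexts fixes
the rational scalars. This is the only link between the covering relations of different stages. -/
theorem _root_.Covers.restrictLattice {C E : Context A} (h : C ≤ E) {x : SpectralLattice C.1}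
    {U : Set (SpectralLattice C.1)} (hx : Covers x U) :
    Covers (restrictLattice h x) (restrictLattice h '' U) :=
  gelfandHom_le_iff_covers.2 fun _ hz =>
    hx.map_le (Order.Frame.hasFrameJoins (GelfandFrame E.1))
      ((gelfandHom E.1).comp (Bohr.restrictLattice h))
      (fun a => gelfandHom_regular (inclusionSA h a))
      fun y hy => hz _ ⟨y, hy, rfl⟩

variable {C : Context A}

/-- The subset of `L_E` that belongs to a closed subfunctor of `L_A|↑C`, for `C ⊆ E`. -/
def stage (U : ClosedSubfunctor A C) {E : Context A} (h : C ≤ E) : Set (SpectralLattice E.1) :=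
  U.1.obj ⟨E, h⟩

theorem le_iff_stage {U V : ClosedSubfunctor A C} :
    U ≤ V ↔ ∀ (E : Context A) (h : C ≤ E), stage U h ⊆ stage V h :=
  ⟨fun k E h => k ⟨E, h⟩, fun k E => k E.1 E.2⟩

theorem ext_stage {U V : ClosedSubfunctor A C}
    (k : ∀ (E : Context A) (h : C ≤ E) (x : SpectralLattice E.1), x ∈ stage U h ↔ x ∈ stage V h) :
    U = V :=
  le_antisymm (le_iff_stage.2 fun E h x => (k E h x).1) (le_iff_stage.2 fun E h x => (k E h x).2)

theorem mem_stage_of_covers {U : ClosedSubfunctor A C} {E : Context A} {h : C ≤ E}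
    {x : SpectralLattice E.1} (hx : Covers x (stage U h)) : x ∈ stage U h :=
  U.2 ⟨E, h⟩ x hx

theorem map_mem_stage {U : ClosedSubfunctor A C} {E E' : Context A} {h : C ≤ E} (k : E ≤ E')
    {x : SpectralLattice E.1} (hx : x ∈ stage U h) :
    restrictLattice k x ∈ stage U (h.trans k) :=
  U.1.map (U := ⟨E, h⟩) (V := ⟨E', h.trans k⟩) (homOfLE k) hx

theorem stage_lower {U : ClosedSubfunctor A C} {E : Context A} {h : C ≤ E}
    {x y : SpectralLattice E.1} (hxy : x ≤ y) (hy : y ∈ stage U h) : x ∈ stage U h :=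
  mem_stage_of_covers ((Covers.of_le hxy).mono (Set.singleton_subset_iff.2 hy))

/-- The closed subfunctor generated by a family of subsets that is stable under restriction. -/
noncomputable def generate (S : ∀ E : Context A, C ≤ E → Set (SpectralLattice E.1))
    (hS : ∀ (E E' : Context A) (h : C ≤ E) (k : E ≤ E'), ∀ x ∈ S E h,
      Covers (restrictLattice k x) (S E' (h.trans k))) : ClosedSubfunctor A C :=
  ⟨{ obj := fun E => {x : SpectralLattice E.1.1 | Covers x (S E.1 E.2)}
     map := fun {E E'} i x hx => (Covers.restrictLattice (leOfHom i) hx).trans (by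
      rintro _ ⟨y, hy, rfl⟩
      exact hS E.1 E'.1 E.2 (leOfHom i) y hy) },
    fun _ _ hd => hd.trans fun _ hy => hy⟩

section Generate

variable {S : ∀ E : Context A, C ≤ E → Set (SpectralLattice E.1)}
    {hS : ∀ (E E' : Context A) (h : C ≤ E) (k : E ≤ E'), ∀ x ∈ S E h,
      Covers (restrictLattice k x) (S E' (h.trans k))}

theorem mem_stage_generate {E : Context A} {h : C ≤ E} {x : SpectralLattice E.1} :
    x ∈ stage (generate S hS) h ↔ Covers x (S E h) := Iff.rfl

theorem generate_le_iff {U : ClosedSubfunctor A C} :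
    generate S hS ≤ U ↔ ∀ (E : Context A) (h : C ≤ E), S E h ⊆ stage U h :=
  ⟨fun k E h _ hx => le_iff_stage.1 k E h (Covers.of_mem hx),
    fun k => le_iff_stage.2 fun E h _ hx => mem_stage_of_covers (hx.mono (k E h))⟩

end Generate

noncomputable instance : SupSet (ClosedSubfunctor A C) where
  sSup W := generate (fun _ h => ⋃ U ∈ W, stage U h) fun E E' h k x hx => by
    simp only [Set.mem_iUnion₂] at hx
    obtain ⟨U, hU, hx⟩ := hx
    exact .of_mem (Set.mem_biUnion hU (map_mem_stage k hx))

theorem mem_stage_sSup {W : Set (ClosedSubfunctor A C)} {E : Context A} {h : C ≤ E}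
    {x : SpectralLattice E.1} : x ∈ stage (sSup W) h ↔ Covers x (⋃ U ∈ W, stage U h) := Iff.rfl

noncomputable instance : Min (ClosedSubfunctor A C) where
  min U V := ⟨U.1 ⊓ V.1, fun D _ hd =>
    ⟨U.2 D _ (hd.mono Set.inter_subset_left), V.2 D _ (hd.mono Set.inter_subset_right)⟩⟩

theorem mem_stage_inf {U V : ClosedSubfunctor A C} {E : Context A} {h : C ≤ E}
    {x : SpectralLattice E.1} : x ∈ stage (U ⊓ V) h ↔ x ∈ stage U h ∧ x ∈ stage V h := Iff.rfl

noncomputable instance : CompleteLattice (ClosedSubfunctor A C) where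
  __ := completeLatticeOfSup (ClosedSubfunctor A C) fun _ =>
    ⟨fun _ hU => le_iff_stage.2 fun _ _ _ hx => Covers.of_mem (Set.mem_biUnion hU hx),
      fun _ hV => generate_le_iff.2 fun E h => Set.iUnion₂_subset fun _ hU =>
        le_iff_stage.1 (hV hU) E h⟩
  -- The meet is fixed to be the stagewise intersection, so that `mem_stage_inf` computes it.
  inf := (· ⊓ ·)
  inf_le_left _ _ := le_iff_stage.2 fun _ _ _ hx => hx.1
  inf_le_right _ _ := le_iff_stage.2 fun _ _ _ hx => hx.2
  le_inf _ _ _ h k := le_iff_stage.2 fun E l _ hx =>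
    ⟨le_iff_stage.1 h E l hx, le_iff_stage.1 k E l hx⟩

theorem mem_stage_top {E : Context A} {h : C ≤ E} {x : SpectralLattice E.1} :
    x ∈ stage (⊤ : ClosedSubfunctor A C) h :=
  have k : generate (fun E (_ : C ≤ E) => Set.univ) (fun _ _ _ _ _ _ => .of_mem trivial) ≤ ⊤ :=
    le_top
  generate_le_iff.1 k E h trivial

/-- The least closed subfunctor is the closure of the empty family, which `Covers.eq_bot`
identifies. -/
theorem mem_stage_bot {E : Context A} {h : C ≤ E} {x : SpectralLattice E.1} :
    x ∈ stage (⊥ : ClosedSubfunctor A C) h ↔ x = ⊥ := by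
  constructor
  · intro hx
    have k : ⊥ ≤ generate (fun E (_ : C ≤ E) => ∅) (fun _ _ _ _ _ hx => hx.elim) := bot_le
    exact (le_iff_stage.1 k E h hx).eq_bot
  · rintro rfl
    exact mem_stage_of_covers (.bot _)

theorem mem_stage_sup {U V : ClosedSubfunctor A C} {E : Context A} {h : C ≤ E}
    {x : SpectralLattice E.1} : x ∈ stage (U ⊔ V) h ↔ Covers x (stage U h ∪ stage V h) := by
  constructor
  · intro hx
    have hU : U ≤ generate (fun E h => stage U h ∪ stage V h) (fun E E' h k x hx => .of_mem
        (hx.imp (map_mem_stage k) (map_mem_stage k))) :=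
      le_iff_stage.2 fun _ _ _ hx => Covers.of_mem (Or.inl hx)
    exact le_iff_stage.1 (sup_le hU (le_iff_stage.2 fun _ _ _ hx => Covers.of_mem (Or.inr hx)))
      E h hx
  · exact fun hx => mem_stage_of_covers (hx.mono (Set.union_subset
      (le_iff_stage.1 le_sup_left E h) (le_iff_stage.1 le_sup_right E h)))

noncomputable instance : Order.Frame (ClosedSubfunctor A C) :=
  .ofMinimalAxioms
    { inf_sSup_le_iSup_inf U W := le_iff_stage.2 fun E h x hx => by
        rw [mem_stage_inf, mem_stage_sSup] at hx
        refine mem_stage_of_covers (Covers.inf (Covers.of_mem hx.1) hx.2 le_rfl le_rfl ?_)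
        intro u hu v hv
        simp only [Set.mem_iUnion₂] at hv
        obtain ⟨V, hV, hv⟩ := hv
        refine le_iff_stage.1 (le_iSup₂_of_le V hV le_rfl) E h ?_
        exact ⟨stage_lower inf_le_left hu, stage_lower inf_le_right hv⟩ }

/-- The truncation of closed subfunctors. -/
noncomputable def truncateClosed {C E : Context A} (h : C ≤ E) (U : ClosedSubfunctor A C) :
    ClosedSubfunctor A E :=
  ⟨truncate h U.1, fun D => U.2 ⟨D.1, h.trans D.2⟩⟩

theorem stage_truncateClosed {C E E' : Context A} (h : C ≤ E) (k : E ≤ E')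
    (U : ClosedSubfunctor A C) : stage (truncateClosed h U) k = stage U (h.trans k) := rfl

/-- The truncation of closed subfunctors, as a lattice homomorphism. -/
noncomputable def truncateHom {C E : Context A} (h : C ≤ E) :
    BoundedLatticeHom (ClosedSubfunctor A C) (ClosedSubfunctor A E) where
  toFun := truncateClosed h
  map_sup' U V := ext_stage fun E' k x => by
    rw [mem_stage_sup, stage_truncateClosed, mem_stage_sup]
    rfl
  map_inf' U V := ext_stage fun E' k x => by
    rw [mem_stage_inf, stage_truncateClosed, mem_stage_inf]
    rfl
  map_top' := ext_stage fun _ _ _ => iff_of_true (mem_stage_top (C := C)) mem_stage_top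
  map_bot' := ext_stage fun E' k x => by
    rw [mem_stage_bot, stage_truncateClosed, mem_stage_bot]

theorem stage_truncateHom {C E E' : Context A} (h : C ≤ E) (k : E ≤ E')
    (U : ClosedSubfunctor A C) : stage (truncateHom h U) k = stage U (h.trans k) := rfl

variable (A) in
/-- The internal frame of closed subfunctors of `L_A`. -/
noncomputable def closedFunctor : Context A ⥤ BddLat.{u} where
  obj C := BddLat.of (ClosedSubfunctor A C)
  map h := BddLat.ofHom (truncateHom (leOfHom h))
  map_id _ := rfl
  map_comp _ _ := rfl

/-- The internal join of a subset of the frame of closed subfunctors. -/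
noncomputable def internalSup (S : Pow (closedFunctor A) C) : ClosedSubfunctor A C :=
  -- Only members living at `E` itself are used: those from earlier stages reappear there as
  -- truncations, since `S` is a subfunctor.
  generate (fun E h => {x | ∃ U : ClosedSubfunctor A E, U ∈ S.obj ⟨E, h⟩ ∧ x ∈ stage U le_rfl})
    fun E E' h k x hx => by
      obtain ⟨U, hU, hx⟩ := hx
      exact .of_mem ⟨truncateHom k U,
        S.map (U := ⟨E, h⟩) (V := ⟨E', h.trans k⟩) (homOfLE k) hU,
        map_mem_stage (U := U) k hx⟩

theorem mem_stage_internalSup {S : Pow (closedFunctor A) C} {E : Context A} {h : C ≤ E}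
    {x : SpectralLattice E.1} : x ∈ stage (internalSup S) h ↔
      Covers x {y | ∃ U : ClosedSubfunctor A E, U ∈ S.obj ⟨E, h⟩ ∧ y ∈ stage U le_rfl} := Iff.rfl

theorem isInternalLUB_internalSup (S : Pow (closedFunctor A) C) :
    IsInternalLUB (closedFunctor A) S (internalSup S) := by
  refine .of_le_iff ?_ ?_
  · intro E h E' k U hU
    refine le_iff_stage.2 fun E'' l x hx => Covers.of_mem ⟨truncateHom l U,
      S.map (U := ⟨E', h.trans k⟩) (V := ⟨E'', (h.trans k).trans l⟩) (homOfLE l) hU, hx⟩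
  · intro E h V hV
    refine le_iff_stage.2 fun E' k x hx => mem_stage_of_covers (hx.mono ?_)
    rintro y ⟨U, hU, hy⟩
    exact le_iff_stage.1 (hV E' k U hU) E' le_rfl hy

theorem isInternalFrame_closedFunctor : IsInternalFrame (closedFunctor A) where
  exists_lub _ S := ⟨_, isInternalLUB_internalSup S⟩
  inf_lub C S j U hj := by
    obtain rfl := hj.unique (isInternalLUB_internalSup S)
    refine .of_le_iff ?_ ?_
    · rintro E h E' k _ ⟨V, hV, rfl⟩
      have := (isInternalLUB_internalSup S).le _ hV
      refine le_of_le_of_eq (inf_le_inf_left _ this) ?_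
      exact (((closedFunctor A).map (homOfLE (h.trans k))).hom.map_inf' _ _).symm
    · intro E h V hV
      refine le_iff_stage.2 fun E' k x hx => ?_
      refine mem_stage_of_covers (Covers.inf (Covers.of_mem hx.1) hx.2 le_rfl le_rfl ?_)
      rintro u hu v ⟨W, hW, hv⟩
      refine le_iff_stage.1 (hV E' k _ ⟨W, hW, rfl⟩) E' le_rfl ?_
      exact ⟨stage_lower (U := truncateHom (h.trans k) U) (h := le_rfl) inf_le_left hu,
        stage_lower inf_le_right hv⟩

/-- The closed subfunctor generated by an element of `L_C`. -/
noncomputable def principal (x : SpectralLattice C.1) : ClosedSubfunctor A C :=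
  generate (fun _ h => {restrictLattice h x}) fun E E' h k y hy => .of_mem (by
    rw [Set.mem_singleton_iff.1 hy, restrictLattice_trans]
    rfl)

theorem mem_stage_principal {x : SpectralLattice C.1} {E : Context A} {h : C ≤ E}
    {y : SpectralLattice E.1} : y ∈ stage (principal x) h ↔ Covers y {restrictLattice h x} :=
  Iff.rfl

/-- A Yoneda-type statement: membership of `x` at the initial stage `C` propagates to all later
stages by restriction. -/
theorem principal_le_iff {x : SpectralLattice C.1} {U : ClosedSubfunctor A C} :
    principal x ≤ U ↔ x ∈ stage U le_rfl := by
  refine generate_le_iff.trans ⟨fun h => ?_, fun h E k => ?_⟩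
  · have := h C le_rfl rfl
    rwa [restrictLattice_refl] at this
  · rintro _ rfl
    exact map_mem_stage k h

theorem truncateHom_principal {E : Context A} (h : C ≤ E) (x : SpectralLattice C.1) :
    truncateHom h (principal x) = principal (restrictLattice h x) :=
  ext_stage fun E' k y => by
    rw [stage_truncateHom, mem_stage_principal, mem_stage_principal, restrictLattice_trans]

variable (C) in
/-- The map from `L_C` to closed subfunctors, as a lattice homomorphism. -/
noncomputable def principalHom :
    BoundedLatticeHom (SpectralLattice C.1) (ClosedSubfunctor A C) where
  toFun := principal
  map_sup' x y := by
    refine le_antisymm (principal_le_iff.2 ?_) (sup_le (principal_le_iff.2 ?_)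
      (principal_le_iff.2 ?_))
    · refine mem_stage_of_covers ((Covers.sup x y).mono ?_)
      rintro _ (rfl | rfl)
      · exact principal_le_iff.1 le_sup_left
      · exact principal_le_iff.1 le_sup_right
    · exact stage_lower le_sup_left (principal_le_iff.1 le_rfl)
    · exact stage_lower le_sup_right (principal_le_iff.1 le_rfl)
  map_inf' x y := by
    refine le_antisymm (le_inf (principal_le_iff.2 ?_) (principal_le_iff.2 ?_))
      (le_iff_stage.2 fun E h z hz => ?_)
    · exact stage_lower inf_le_left (principal_le_iff.1 le_rfl)
    · exact stage_lower inf_le_right (principal_le_iff.1 le_rfl)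
    · refine Covers.inf (mem_stage_principal.1 hz.1) (mem_stage_principal.1 hz.2) le_rfl le_rfl ?_
      rintro _ rfl _ rfl
      exact (map_inf (restrictLattice h) x y).symm
  map_top' := top_le_iff.1 <| le_iff_stage.2 fun E h y _ => mem_stage_principal.2 <| by
    rw [map_top]
    exact .of_le le_top
  map_bot' := le_bot_iff.1 (principal_le_iff.2 (mem_stage_of_covers (.bot _)))

variable (A) in
/-- The generators of the internal frame of closed subfunctors. -/
noncomputable def closedGenerators :
    selfAdjointFunctor A ⟶ closedFunctor A ⋙ forget BddLat where
  app C := ↾(fun a : selfAdjoint C.1 => (principal (SpectralLattice.D a) : ClosedSubfunctor A C))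
  naturality C E h := by
    ext a
    exact (truncateHom_principal (leOfHom h) (SpectralLattice.D a)).symm

theorem spectralRelations_map {B : Type u} [CommCStarAlgebra B] {X : Type*} [Lattice X]
    [BoundedOrder X] (f : BoundedLatticeHom (SpectralLattice B) X) :
    SpectralRelations B fun a => f (SpectralLattice.D a) where
  one := by rw [SpectralLattice.relations.one, map_top]
  inf_neg a := by rw [← map_inf, SpectralLattice.relations.inf_neg, map_bot]
  neg_sq b := by rw [SpectralLattice.relations.neg_sq, map_bot]
  add_le a b := by
    rw [← map_sup]
    exact OrderHomClass.mono f (SpectralLattice.relations.add_le a b)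
  mul a b := by rw [SpectralLattice.relations.mul, map_sup, map_inf, map_inf]

theorem gelfandRelations_closedGenerators (C : Context A) :
    GelfandRelations C.1 (X := (closedFunctor A).obj C) ((closedGenerators A).app C) where
  toSpectralRelations := spectralRelations_map (principalHom C)
  regular a U hU := by
    refine principal_le_iff.2 (mem_stage_of_covers ((Covers.regular a).mono ?_))
    rintro _ ⟨r, hr, rfl⟩
    exact principal_le_iff.1 (hU r hr)

end Bohr

/-! ### The universal properties. -/

/-- A lattice whose meets distribute over arbitrary joins is distributive. -/
abbrev HasFrameJoins.distribLattice {X : Type*} [Lattice X] (hX : HasFrameJoins X) :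
    DistribLattice X :=
  .ofInfSupLe hX.inf_sup_le

namespace Bohr

open Kripke

variable {A : Type u} [CStarAlgebra A]

/-- The theory of distributive lattices with these relations is algebraic, so the free model is
formed stage by stage; naturality of the extension is checked on generators. -/
theorem isSpectralLattice : IsSpectralLattice A (spectralLattice A) (generators A) where
  relations _ := SpectralLattice.relations
  universal M E hE := by
    refine ⟨{ app C := BddDistLat.ofHom (SpectralLattice.lift (E.app C) (hE C))
              naturality C C' h := BddDistLat.hom_ext (SpectralLattice.hom_ext fun a =>
                ConcreteCategory.congr_hom (E.naturality h) a) }, ?_, ?_⟩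
    · ext C a
      rfl
    · intro φ hφ
      subst hφ
      refine NatTrans.ext (funext fun C => BddDistLat.hom_ext (SpectralLattice.hom_ext fun a => ?_))
      rfl

section Universal

variable {G : Context A ⥤ BddLat.{u}} (hG : IsInternalFrame G)
  {E : selfAdjointFunctor A ⟶ G ⋙ forget BddLat}
  (hE : ∀ C : Context A, GelfandRelations C.1 (X := G.obj C) (E.app C))

/-- The extension to `L_C` of generators of an internal frame that satisfy the relations. -/
noncomputable def extend (C : Context A) : BoundedLatticeHom (SpectralLattice C.1) (G.obj C) :=
  -- `lift` needs a distributive target, while an internal frame is only given as a lattice at each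
  -- stage.
  letI := (hG.hasFrameJoins C).distribLattice
  SpectralLattice.lift (X := G.obj C) (E.app C) (hE C).toSpectralRelations

theorem eq_extend {C : Context A} {f : BoundedLatticeHom (SpectralLattice C.1) (G.obj C)}
    (hf : ∀ a : selfAdjoint C.1, f (SpectralLattice.D a) = E.app C a) : f = extend hG hE C :=
  let := (hG.hasFrameJoins C).distribLattice
  SpectralLattice.hom_ext (X := G.obj C) hf

theorem extend_restrictLattice {C C' : Context A} (h : C ≤ C') (x : SpectralLattice C.1) :
    extend hG hE C' (restrictLattice h x) = G.map (homOfLE h) (extend hG hE C x) := by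
  let := (hG.hasFrameJoins C').distribLattice
  exact DFunLike.congr_fun (SpectralLattice.hom_ext (X := G.obj C')
    (f := (extend hG hE C').comp (restrictLattice h))
    (g := (G.map (homOfLE h)).hom.comp (extend hG hE C))
    fun a => ConcreteCategory.congr_hom (E.naturality (homOfLE h)) a) x

theorem extend_le_of_covers {C : Context A} {x : SpectralLattice C.1}
    {U : Set (SpectralLattice C.1)} (hx : Covers x U) {z : G.obj C}
    (hz : ∀ y ∈ U, extend hG hE C y ≤ z) : extend hG hE C x ≤ z :=
  hx.map_le (hG.hasFrameJoins C) (extend hG hE C) (hE C).regular hz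

variable {C : Context A}

/-- The internal subset of `G` that consists of the images of the elements of `U`. -/
noncomputable def extendImage (U : ClosedSubfunctor A C) : Pow G C where
  obj r := extend hG hE r.1 '' stage U r.2
  map {r t} i := by
    rintro _ ⟨x, hx, rfl⟩
    exact ⟨_, map_mem_stage (leOfHom i) hx, extend_restrictLattice hG hE (leOfHom i) x⟩

/-- The join in `G` of the images of the elements of a closed subfunctor. -/
noncomputable def extendClosed (U : ClosedSubfunctor A C) : G.obj C :=
  (hG.exists_lub C (extendImage hG hE U)).choose

theorem isInternalLUB_extendClosed (U : ClosedSubfunctor A C) :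
    IsInternalLUB G (extendImage hG hE U) (extendClosed hG hE U) :=
  (hG.exists_lub C (extendImage hG hE U)).choose_spec

theorem extendClosed_le_iff {U : ClosedSubfunctor A C} {z : G.obj C} :
    extendClosed hG hE U ≤ z ↔ ∀ (r : Context A) (k : C ≤ r), ∀ x ∈ stage U k,
      extend hG hE r x ≤ G.map (homOfLE k) z := by
  refine (isInternalLUB_extendClosed hG hE U).le_iff.trans ⟨fun h r k x hx => ?_, ?_⟩
  · exact h r k _ ⟨x, hx, rfl⟩
  · rintro h r k _ ⟨x, hx, rfl⟩
    exact h r k x hx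

/-- Internal least upper bounds are tested at all later stages, so they are stable under
restriction. -/
theorem map_extendClosed {C' : Context A} (h : C ≤ C') (U : ClosedSubfunctor A C) :
    G.map (homOfLE h) (extendClosed hG hE U) = extendClosed hG hE (truncateHom h U) := by
  refine eq_of_forall_ge_iff fun z => ?_
  rw [extendClosed_le_iff]
  refine (isInternalLUB_extendClosed hG hE U C' h z).trans ⟨fun k r l x hx => ?_, ?_⟩
  · exact k r l _ ⟨x, hx, rfl⟩
  · rintro k r l _ ⟨x, hx, rfl⟩
    exact k r l x hx

theorem extend_le_map_extendClosed {U : ClosedSubfunctor A C} {r : Context A} (k : C ≤ r)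
    {x : SpectralLattice r.1} (hx : x ∈ stage U k) :
    extend hG hE r x ≤ G.map (homOfLE k) (extendClosed hG hE U) :=
  (extendClosed_le_iff hG hE).1 le_rfl r k x hx

theorem extendClosed_mono {U V : ClosedSubfunctor A C} (h : U ≤ V) :
    extendClosed hG hE U ≤ extendClosed hG hE V :=
  (extendClosed_le_iff hG hE).2 fun r k _ hx =>
    extend_le_map_extendClosed hG hE k (le_iff_stage.1 h r k hx)

theorem extendClosed_principal (x : SpectralLattice C.1) :
    extendClosed hG hE (principal x) = extend hG hE C x := by
  refine le_antisymm ((extendClosed_le_iff hG hE).2 fun r k y hy => ?_) ?_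
  · refine extend_le_of_covers hG hE (mem_stage_principal.1 hy) ?_
    rintro _ rfl
    exact (extend_restrictLattice hG hE k x).le
  · have h := extend_le_map_extendClosed hG hE le_rfl (principal_le_iff.1 (le_refl (principal x)))
    rwa [map_homOfLE_refl] at h

theorem inf_extendClosed_le_iff {U : ClosedSubfunctor A C} {w z : G.obj C} :
    w ⊓ extendClosed hG hE U ≤ z ↔ ∀ (r : Context A) (k : C ≤ r), ∀ x ∈ stage U k,
      G.map (homOfLE k) w ⊓ extend hG hE r x ≤ G.map (homOfLE k) z := by
  refine (hG.inf_lub C _ _ w (isInternalLUB_extendClosed hG hE U)).le_iff.trans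
    ⟨fun h r k x hx => ?_, ?_⟩
  · exact h r k _ ⟨_, ⟨x, hx, rfl⟩, rfl⟩
  · rintro h r k _ ⟨_, ⟨x, hx, rfl⟩, rfl⟩
    exact h r k x hx

/-- The internal distributive law is applied to `V` and then, at a later stage, to `U`. What remains
is a meet of an element of `U` with a restricted element of `V`, which lies in both because stages
are lower sets. -/
theorem extendClosed_inf (U V : ClosedSubfunctor A C) :
    extendClosed hG hE (U ⊓ V) = extendClosed hG hE U ⊓ extendClosed hG hE V := by
  refine le_antisymm (le_inf (extendClosed_mono hG hE inf_le_left)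
    (extendClosed_mono hG hE inf_le_right)) ?_
  rw [inf_extendClosed_le_iff]
  intro r k v hv
  rw [map_extendClosed, map_extendClosed, inf_comm, inf_extendClosed_le_iff]
  intro s l u hu
  rw [← extend_restrictLattice, ← map_inf]
  exact extend_le_map_extendClosed hG hE l (U := truncateHom k (U ⊓ V))
    ⟨stage_lower (U := truncateHom k U) (h := l) inf_le_right hu,
      stage_lower (U := truncateHom k V) (h := l) inf_le_left (map_mem_stage (U := V) l hv)⟩

theorem extendClosed_sup (U V : ClosedSubfunctor A C) :
    extendClosed hG hE (U ⊔ V) = extendClosed hG hE U ⊔ extendClosed hG hE V := by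
  refine le_antisymm ((extendClosed_le_iff hG hE).2 fun r k x hx => ?_)
    (sup_le (extendClosed_mono hG hE le_sup_left) (extendClosed_mono hG hE le_sup_right))
  refine extend_le_of_covers hG hE (mem_stage_sup.1 hx) ?_
  rintro y (hy | hy)
  · exact (extend_le_map_extendClosed hG hE k hy).trans (map_mono G _ le_sup_left)
  · exact (extend_le_map_extendClosed hG hE k hy).trans (map_mono G _ le_sup_right)

/-- The morphism from the internal frame of closed subfunctors that extends given generators. -/
noncomputable def extendHom : closedFunctor A ⟶ G where
  app C := BddLat.ofHom
    { toFun := fun U : ClosedSubfunctor A C => extendClosed hG hE U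
      map_sup' := extendClosed_sup hG hE
      map_inf' := extendClosed_inf hG hE
      map_top' := by
        change extendClosed hG hE ⊤ = ⊤
        -- Both top elements are images of the top of `L_C`, where `extendClosed_principal` applies.
        rw [← map_top (principalHom C), ← map_top (extend hG hE C)]
        exact extendClosed_principal hG hE ⊤
      map_bot' := by
        change extendClosed hG hE ⊥ = ⊥
        rw [← map_bot (principalHom C), ← map_bot (extend hG hE C)]
        exact extendClosed_principal hG hE ⊥ }
  naturality C C' h := by
    refine BddLat.ext fun U => ?_
    exact (map_extendClosed hG hE (leOfHom h) U).symm

theorem isInternalFrameHom_extendHom : IsInternalFrameHom (extendHom hG hE) := by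
  intro C S j hj
  obtain rfl := hj.unique (isInternalLUB_internalSup S)
  refine .of_le_iff ?_ ?_
  · rintro C' h r k _ ⟨U, hU, rfl⟩
    exact (app_mono (extendHom hG hE) (hj.le (h.trans k) hU)).trans_eq
      (app_naturality (extendHom hG hE) _ _)
  · intro C' h z hz
    have hz' (r : Context A) (k : C' ≤ r) (U : ClosedSubfunctor A r)
        (hU : U ∈ S.obj ⟨r, h.trans k⟩) : extendClosed hG hE U ≤ G.map (homOfLE k) z :=
      hz r k _ ⟨U, hU, rfl⟩
    change G.map (homOfLE h) (extendClosed hG hE (internalSup S)) ≤ z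
    rw [map_extendClosed, extendClosed_le_iff]
    intro r k x hx
    rw [stage_truncateHom, mem_stage_internalSup] at hx
    refine extend_le_of_covers hG hE hx ?_
    rintro y ⟨U, hU, hy⟩
    have h₁ := extend_le_map_extendClosed hG hE le_rfl hy
    rw [map_homOfLE_refl] at h₁
    exact h₁.trans (hz' r k U hU)

/-- On principal subfunctors `φ` is determined by the generators. Every closed subfunctor is the
internal join `S` of the principal ones below it, and `φ` preserves that join. -/
theorem eq_extendHom {φ : closedFunctor A ⟶ G} (hφ : IsInternalFrameHom φ)
    (h : closedGenerators A ≫ Functor.whiskerRight φ (forget BddLat) = E) :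
    φ = extendHom hG hE := by
  let g (C : Context A) : BoundedLatticeHom (ClosedSubfunctor A C) (G.obj C) := (φ.app C).hom
  have hg (C : Context A) (a : selfAdjoint C.1) :
      g C (principal (SpectralLattice.D a)) = E.app C a := by
    subst h
    rfl
  have hp (C : Context A) (x : SpectralLattice C.1) : g C (principal x) = extend hG hE C x :=
    DFunLike.congr_fun (eq_extend hG hE (f := (g C).comp (principalHom C)) (hg C)) x
  refine NatTrans.ext (funext fun C => BddLat.ext fun U => ?_)
  let S : Pow (closedFunctor A) C :=
    { obj r := {V : ClosedSubfunctor A r.1 | ∃ x ∈ stage U r.2, V = principal x}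
      map {r t} i := by
        rintro _ ⟨x, hx, rfl⟩
        exact ⟨_, map_mem_stage (leOfHom i) hx, truncateHom_principal (leOfHom i) x⟩ }
  have hS : IsInternalLUB (closedFunctor A) S U := by
    refine .of_le_iff ?_ ?_
    · rintro C' h r k _ ⟨x, hx, rfl⟩
      exact principal_le_iff.2 hx
    · intro C' h V hV
      exact le_iff_stage.2 fun r k x hx => principal_le_iff.1 (hV r k _ ⟨x, hx, rfl⟩)
  refine (hφ C S U hS).unique ?_
  have e : image φ S = extendImage hG hE U := by
    ext r y
    constructor
    · rintro ⟨_, ⟨x, hx, rfl⟩, rfl⟩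
      exact ⟨x, hx, (hp r.1 x).symm⟩
    · rintro ⟨x, hx, rfl⟩
      exact ⟨_, ⟨x, hx, rfl⟩, (hp r.1 x).symm⟩
  rw [e]
  exact isInternalLUB_extendClosed hG hE U

end Universal

theorem isGelfandSpectrum_closedFunctor :
    IsGelfandSpectrum A (closedFunctor A) (closedGenerators A) where
  isFrame := isInternalFrame_closedFunctor
  relations := gelfandRelations_closedGenerators
  universal G E hG hE := by
    refine ⟨extendHom hG hE, ⟨isInternalFrameHom_extendHom hG hE, ?_⟩,
      fun φ hφ => eq_extendHom hG hE hφ.1 hφ.2⟩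
    ext C a
    exact extendClosed_principal hG hE (SpectralLattice.D a)

/-- Two internal Gelfand spectra are isomorphic, compatibly with the generators. -/
theorem IsGelfandSpectrum.exists_iso {O O' : Context A ⥤ BddLat.{u}}
    {D : selfAdjointFunctor A ⟶ O ⋙ forget BddLat} {D' : selfAdjointFunctor A ⟶ O' ⋙ forget BddLat}
    (hO : IsGelfandSpectrum A O D) (hO' : IsGelfandSpectrum A O' D') :
    ∃ φ : O ≅ O', D ≫ Functor.whiskerRight φ.hom (forget BddLat) = D' := by
  obtain ⟨φ, ⟨hφ, hφD⟩, -⟩ := hO.universal O' D' hO'.isFrame hO'.relations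
  obtain ⟨ψ, ⟨hψ, hψD⟩, -⟩ := hO'.universal O D hO.isFrame hO.relations
  refine ⟨⟨φ, ψ, ?_, ?_⟩, hφD⟩
  · refine (hO.universal O D hO.isFrame hO.relations).unique ⟨hφ.comp hψ, ?_⟩ ⟨.id O, ?_⟩
    · rw [Functor.whiskerRight_comp, ← Category.assoc, hφD, hψD]
    · rw [Functor.whiskerRight_id', Category.comp_id]
  · refine (hO'.universal O' D' hO'.isFrame hO'.relations).unique ⟨hψ.comp hφ, ?_⟩ ⟨.id O', ?_⟩
    · rw [Functor.whiskerRight_comp, ← Category.assoc, hψD, hφD]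
    · rw [Functor.whiskerRight_id', Category.comp_id]

/-! ### The external description -/

theorem _root_.Kripke.Alx.mem_of_le {P : Type u} [PartialOrder P] (V : Alx P) {p q : P} (h : p ≤ q)
    (hp : Topology.WithUpperSet.toUpperSet p ∈ V) : Topology.WithUpperSet.toUpperSet q ∈ V :=
  Topology.IsUpperSet.isOpen_iff_isUpperSet.1 V.2 h hp

/-- The closed subfunctor that is everything on an open set and least elsewhere. -/
noncomputable def ofOpen (V : Alx (Context A)) : ClosedSubfunctor A ⊥ :=
  generate (fun E _ => {_x | Topology.WithUpperSet.toUpperSet E ∈ V}) fun _ _ _ k _ hx => .of_mem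
    (V.mem_of_le k hx)

/-- Outside `V` the generating set is empty, and its closure contains only `⊥`. -/
theorem mem_stage_ofOpen {V : Alx (Context A)} {E : Context A} {h : ⊥ ≤ E}
    {x : SpectralLattice E.1} :
    x ∈ stage (ofOpen V) h ↔ x = ⊥ ∨ Topology.WithUpperSet.toUpperSet E ∈ V := by
  refine mem_stage_generate.trans ⟨fun hx => or_iff_not_imp_right.2 fun hE => ?_, ?_⟩
  · exact (hx.trans (V := ∅) fun _ hy => absurd hy hE).eq_bot
  · rintro (rfl | hE)
    · exact .bot _
    · exact .of_mem hE

theorem ofOpen_le_iff {V : Alx (Context A)} {U : ClosedSubfunctor A ⊥} :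
    ofOpen V ≤ U ↔ ∀ E : Context A, Topology.WithUpperSet.toUpperSet E ∈ V →
      ∀ x, x ∈ stage U (bot_le : ⊥ ≤ E) :=
  generate_le_iff.trans ⟨fun h E hE _ => h E bot_le hE, fun h E _ x hE => h E hE x⟩

/-- The inverse image map of the external description of the frame of closed subfunctors. -/
noncomputable def ofOpenHom : FrameHom (Alx (Context A)) (ClosedSubfunctor A ⊥) where
  toFun := ofOpen
  map_inf' V W := ext_stage fun E h x => by
    rw [mem_stage_inf, mem_stage_ofOpen, mem_stage_ofOpen, mem_stage_ofOpen, ← or_and_left]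
    rfl
  map_top' := ext_stage fun E h x =>
    iff_of_true (mem_stage_ofOpen.2 (Or.inr trivial)) mem_stage_top
  map_sSup' s := eq_of_forall_ge_iff fun U => by
    rw [sSup_le_iff, Set.forall_mem_image, ofOpen_le_iff]
    simp only [ofOpen_le_iff, Opens.mem_sSup]
    exact ⟨fun h V hV E hE => h E ⟨V, hV, hE⟩, fun h E ⟨V, hV, hE⟩ => h hV E hE⟩

theorem stage_ofOpen_up_of_le {C E : Context A} (h : C ≤ E) :
    stage (ofOpen (Alx.up C)) (bot_le : ⊥ ≤ E) = Set.univ :=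
  Set.eq_univ_of_forall fun _ => mem_stage_ofOpen.2 (Or.inr h)

theorem stage_ofOpen_up_of_not_le {C E : Context A} (h : ¬ C ≤ E) :
    stage (ofOpen (Alx.up C)) (bot_le : ⊥ ≤ E) = {⊥} :=
  Set.ext fun _ => mem_stage_ofOpen.trans (or_iff_left h)

/-- The closed subfunctor generated by a section over an open set. -/
noncomputable def ofSection (V : Alx (Context A)) (s : Sections (closedFunctor A) V) :
    ClosedSubfunctor A ⊥ :=
  generate (fun E _ => {x | ∃ hE : Topology.WithUpperSet.toUpperSet E ∈ V,
      x ∈ stage (s.1 ⟨E, hE⟩ : ClosedSubfunctor A E) le_rfl})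
    fun E E' h k x ⟨hE, hx⟩ => .of_mem
      ⟨V.mem_of_le k hE, by
        rw [← s.2 ⟨E, hE⟩ ⟨E', _⟩ k]
        exact map_mem_stage (U := (s.1 ⟨E, hE⟩ : ClosedSubfunctor A E)) k hx⟩

/-- By compatibility, the stage at `E` of any value of `s` below `E` agrees with that of `s` at `E`,
so the order on sections can be tested at the initial stages of their values. -/
theorem gc_ofSection (V : Alx (Context A)) :
    GaloisConnection (ofSection V) (restrictSection (closedFunctor A) V) := by
  intro s U
  refine generate_le_iff.trans ⟨fun h p => le_iff_stage.2 fun E k x hx => ?_, ?_⟩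
  · have hE : Topology.WithUpperSet.toUpperSet E ∈ V :=
      V.mem_of_le k p.2
    refine h E bot_le ⟨hE, ?_⟩
    rw [← s.2 p ⟨E, hE⟩ k]
    exact hx
  · rintro h E k x ⟨hE, hx⟩
    exact le_iff_stage.1 (h ⟨E, hE⟩) E le_rfl hx

theorem ofSection_topSection (V : Alx (Context A)) :
    ofSection V (topSection (closedFunctor A) V) = ofOpen V :=
  eq_of_forall_ge_iff fun _ => generate_le_iff.trans
    ⟨fun h => ofOpen_le_iff.2 fun E hE _ => h E bot_le ⟨hE, mem_stage_top (C := E)⟩,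
      fun h E _ _ ⟨hE, _⟩ => ofOpen_le_iff.1 h E hE _⟩

theorem isExternalDescription_ofOpenHom :
    IsExternalDescription (closedFunctor A) (ofOpenHom (A := A)) := fun V =>
  ⟨ofSection V, gc_ofSection V, (ofSection_topSection V).symm⟩

end Bohr

/-! ### Transport along isomorphisms of internal lattices. -/

namespace Kripke

variable {P : Type u} [PartialOrder P] {F G : P ⥤ BddLat.{u}}

/-- The order isomorphism at one stage of an isomorphism of internal lattices. -/
def orderIsoApp (φ : F ≅ G) (p : P) : F.obj p ≃o G.obj p where
  toFun := φ.hom.app p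
  invFun := φ.inv.app p
  left_inv x := by
    rw [← ConcreteCategory.comp_apply, φ.hom_inv_id_app, ConcreteCategory.id_apply]
  right_inv x := by
    rw [← ConcreteCategory.comp_apply, φ.inv_hom_id_app, ConcreteCategory.id_apply]
  map_rel_iff' {x y} := by
    refine ⟨fun h => ?_, app_mono φ.hom⟩
    have k := app_mono φ.inv h
    change φ.inv.app p (φ.hom.app p x) ≤ φ.inv.app p (φ.hom.app p y) at k
    rwa [← ConcreteCategory.comp_apply, ← ConcreteCategory.comp_apply, φ.hom_inv_id_app,
      ConcreteCategory.id_apply, ConcreteCategory.id_apply] at k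

/-- The image of a section under a morphism of internal lattices. -/
def mapSection (φ : F ⟶ G) (U : Alx P) (s : Sections F U) : Sections G U :=
  ⟨fun p => φ.app p.1 (s.1 p), fun p q h => by rw [← app_naturality, s.2 p q h]⟩

theorem IsExternalDescription.of_iso [OrderBot P] (φ : F ≅ G) {f : Alx P → G.obj ⊥}
    (hf : IsExternalDescription G f) :
    IsExternalDescription F fun U => (orderIsoApp φ ⊥).symm (f U) := by
  intro U
  obtain ⟨l, hl, hfl⟩ := hf U
  refine ⟨fun s => (orderIsoApp φ ⊥).symm (l (mapSection φ.hom U s)), fun s x => ?_, ?_⟩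
  · rw [OrderIso.symm_apply_le, hl]
    refine forall_congr' fun p => ?_
    refine Iff.trans (iff_of_eq (congrArg (φ.hom.app p.1 (s.1 p) ≤ ·) ?_))
      (orderIsoApp φ p.1).le_iff_le
    exact (app_naturality φ.hom _ x).symm
  · dsimp only
    rw [hfl]
    congr 2
    exact Subtype.ext (funext fun p => (map_top (φ.hom.app p.1).hom).symm)

end Kripke

namespace Bohr

open Kripke

variable (A : Type u) [CStarAlgebra A]

/-- Closed subfunctors of `L_A|↑ℂ` are closed subfunctors of `L_A`. -/
noncomputable def globalEquiv : ClosedSubfunctor A ⊥ ≃o GlobalClosedSubfunctor A where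
  toFun U := ⟨{ obj := fun E => stage U (bot_le : ⊥ ≤ E)
                map := fun i _ hx => map_mem_stage (U := U) (leOfHom i) hx },
    fun _ _ hc => mem_stage_of_covers hc⟩
  invFun U := ⟨{ obj := fun E => U.1.obj E.1
                 map := fun i => U.1.map (homOfLE (leOfHom i)) }, fun D => U.2 D.1⟩
  left_inv _ := rfl
  right_inv _ := rfl
  map_rel_iff' := ⟨fun h => le_iff_stage.2 fun E _ => h E, fun h E => le_iff_stage.1 h E bot_le⟩

end Bohr

theorem mainTheorem3 (A : Type u) [CStarAlgebra A] :
    -- the functor `C ↦ L_C` is the internal spectral lattice of the Bohrification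
    Bohr.IsSpectralLattice A (Bohr.spectralLattice A) (Bohr.generators A) ∧
    -- the internal Gelfand spectrum exists
    (∃ (O : Context A ⥤ BddLat.{u})
      (D : Bohr.selfAdjointFunctor A ⟶ O ⋙ forget BddLat), Bohr.IsGelfandSpectrum A O D) ∧
    ∀ (O : Context A ⥤ BddLat.{u}) (D : Bohr.selfAdjointFunctor A ⟶ O ⋙ forget BddLat),
      Bohr.IsGelfandSpectrum A O D →
      -- its value at `C` consists of the closed subfunctors of `L_A|↑C`
      ∃ Φ : ∀ C : Context A, O.obj C ≃o Bohr.ClosedSubfunctor A C,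
        (∀ (C : Context A) (a : selfAdjoint C.1) (E : Set.Ici C),
          (Φ C (D.app C a)).1.obj E = {x : SpectralLattice E.1.1 |
            Covers x {SpectralLattice.D (Bohr.inclusionSA E.2 a)}}) ∧
        -- at `ℂ`, it consists of the closed subfunctors of `L_A`
        (∃ Ψ : O.obj ⊥ ≃o Bohr.GlobalClosedSubfunctor A,
          ∀ (x : O.obj ⊥) (E : Context A), (Ψ x).1.obj E = (Φ ⊥ x).1.obj ⟨E, Set.mem_Ici.2 bot_le⟩) ∧
        -- the restriction maps are given by truncation
        (∀ (C E : Context A) (h : C ≤ E) (x : O.obj C),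
          (Φ E (O.map (homOfLE h) x)).1 = Kripke.truncate h (Φ C x).1) ∧
        -- the external description
        ∃ (X : Frm.{u}) (e : X ≃o O.obj ⊥) (f : FrameHom (Kripke.Alx (Context A)) X),
          Kripke.IsExternalDescription O (fun U => e (f U)) ∧
          ∀ C E : Context A,
            (C ≤ E → (Φ ⊥ (e (f (Kripke.Alx.up C)))).1.obj ⟨E, Set.mem_Ici.2 bot_le⟩ = Set.univ) ∧
            (¬ C ≤ E → (Φ ⊥ (e (f (Kripke.Alx.up C)))).1.obj ⟨E, Set.mem_Ici.2 bot_le⟩ =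
              {(⊥ : SpectralLattice E.1)}) := by
  refine ⟨Bohr.isSpectralLattice, ⟨_, _, Bohr.isGelfandSpectrum_closedFunctor⟩, fun O D hO => ?_⟩
  -- An arbitrary spectrum `O` is compared with the concrete model; the components of `φ` are the
  -- isomorphisms `Φ`, and its naturality is the truncation formula.
  obtain ⟨φ, hφ⟩ := hO.exists_iso Bohr.isGelfandSpectrum_closedFunctor
  let Φ (C : Context A) : O.obj C ≃o Bohr.ClosedSubfunctor A C := Kripke.orderIsoApp φ C
  have hΦ (C : Context A) (U : Bohr.ClosedSubfunctor A C) : Φ C ((Φ C).symm U) = U :=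
    (Φ C).apply_symm_apply U
  refine ⟨Φ, fun C a E => ?_, ⟨(Φ ⊥).trans (Bohr.globalEquiv A), fun x E => rfl⟩,
    fun C E h x => ?_, Frm.of (Bohr.ClosedSubfunctor A ⊥), (Φ ⊥).symm, Bohr.ofOpenHom,
    Bohr.isExternalDescription_ofOpenHom.of_iso φ, fun C E => ⟨fun h => ?_, fun h => ?_⟩⟩
  · have h : Φ C (D.app C a) = Bohr.principal (SpectralLattice.D a) :=
      ConcreteCategory.congr_hom (NatTrans.congr_app hφ C) a
    rw [h]
    rfl
  · exact congrArg Subtype.val (Kripke.app_naturality φ.hom (homOfLE h) x)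
  · rw [hΦ]
    exact Bohr.stage_ofOpen_up_of_le h
  · rw [hΦ]
    exact Bohr.stage_ofOpen_up_of_not_le h
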